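/- Let $d\in\mathbb N$ and let $f:\mathbb R^d\to\mathbb R$ be $C^1$, $\mu$-strongly convex ($\mu>0$) and $L$-smooth ($L>0$: $\|\nabla f(y)-\nabla f(x)\|\le L\|y-x\|$ for all $x,y$, Euclidean norm), with global minimizer $x^*$. Let $\beta\in(0,1)$, $\varepsilon>0$, $\eta_0\in(0,2\varepsilon/L)$, and let $\eta_1>0$ satisfy $\eta_0+\eta_1<2\varepsilon/L$. On the state space $\mathbb R^d\times\mathbb R_{\ge0}^d$, with the metric of the norm $\|\cdot\|_\infty$, consider RMSProp with step size $\eta(u)=\eta_0+u$, $u\ge 0$: $$s_i^+=(1-\beta)s_i+\beta(\nabla_i f(x))^2,\qquad x_i^+=x_i-\frac{\eta_0+u}{\varepsilon+\sqrt{s_i^+}}\,\nabla_i f(x),\qquad i=1,\dots,d,$$ where at time $t\in\mathbb N_0$ the input is $u=u(t)$. Let $$\gamma_1=\frac{12\beta^{3/2}\sqrt L}{\eta_0\varepsilon},\qquad \gamma_0=\max\Big\{\frac{3\beta}{\eta_0},\ \frac{\beta\varepsilon}{\eta_0\big(\varepsilon-\frac{(\eta_0+\eta_1)L}{2}\big)},\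 \frac{\gamma_1\eta_0\sqrt{Ld}}{\sqrt\beta}+\frac{12\beta L\sqrt d}{\varepsilon}\Big\},$$ $$\gamma(\omega)=\gamma_0\omega+\tfrac23\gamma_1\omega^{3/2},\qquad h(\omega)=\sqrt\omega+\varepsilon\log\varepsilon-\varepsilon\log(\sqrt\omega+\varepsilon),\qquad V(x,s)=\gamma(f(x)-f(x^*))+2\sum_{i=1}^d h(s_i).$$ A function $[0,\infty)\to[0,\infty)$ is of class $\mathcal K$ if it is continuous, strictly increasing and zero at $0$, and of class $\mathcal K_\infty$ if it is moreover unbounded; $b:[0,\infty)^2\to[0,\infty)$ is of class $\mathcal{KL}$ if $b(\cdot,t)\in\mathcal K$ for each $t$, and $b(r,\cdot)$ is nonincreasing with limit $0$ at infinity for each $r$. Then: 1. (Global asymptotic stability.) For $u\equiv0$, $(x^*,0)$ is an equilibrium, it is Lyapunov stable, and every trajectory converges to it. 2. (Input-to-state stability.) There are $b\in\mathcal{KL}$ and $g\in\mathcal K$ such that for every initial state $(x(0),s(0))\in\mathbb R^d\times\mathbb R_{\ge0}^d$, every bounded $u:\mathbb N_0\to[0,\infty)$ and every $t\in\mathbb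 N_0$, $$\|(x(t)-x^*,s(t))\|_\infty\le b\big(\|(x(0)-x^*,s(0))\|_\infty,t\big)+g\big(\sup_k u(k)\big).$$ 3. ($V$ is an ISS-Lyapunov function.) $V$ is continuous, and there are $\alpha_1,\alpha_2,\alpha_V,\chi_V\in\mathcal K_\infty$ such that for all $(x,s)\in\mathbb R^d\times\mathbb R_{\ge0}^d$ and all $u\ge0$, $$\alpha_1(\|(x-x^*,s)\|_\infty)\le V(x,s)\le\alpha_2(\|(x-x^*,s)\|_\infty),$$ $$V(x^+,s^+)-V(x,s)\le-\alpha_V(\|(x-x^*,s)\|_\infty)+\chi_V(u).$$ -/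

import Mathlib

open Set Filter Topology

noncomputable section

/-- Class `𝒦`: continuous and strictly increasing on `[0, ∞)`, vanishing at `0`. -/
def ClassK (α : ℝ → ℝ) : Prop :=
  ContinuousOn α (Ici 0) ∧ StrictMonoOn α (Ici 0) ∧ α 0 = 0

/-- Class `𝒦∞`: class `𝒦` and unbounded. -/
def ClassKInf (α : ℝ → ℝ) : Prop :=
  ClassK α ∧ Tendsto α atTop atTop

/-- Class `𝒦ℒ`: class `𝒦` in the first argument, decreasing to `0` in the second one. -/
def ClassKL (b : ℝ → ℝ → ℝ) : Prop :=
  (∀ t, 0 ≤ t → ClassK fun r => b r t) ∧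
    ∀ r, 0 ≤ r → AntitoneOn (b r) (Ici 0) ∧ Tendsto (b r) atTop (𝓝 0)

/-- The admissible inputs: bounded sequences of nonnegative reals. -/
def IsBoundedInput (u : ℕ → ℝ) : Prop :=
  (∀ t, 0 ≤ u t) ∧ BddAbove (range u)

/-- The solution of `z (t + 1) = F (z t) (u t)` starting at `z₀`. -/
def trajectory {X : Type*} (F : X → ℝ → X) (u : ℕ → ℝ) (z₀ : X) : ℕ → X
  | 0 => z₀
  | t + 1 => F (trajectory F u z₀ t) (u t)

/-- The zero-input system `z (t + 1) = F (z t) 0` has the equilibrium `zeq`, which is Lyapunov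
stable and attracts every trajectory. -/
def IsGloballyAsymptoticallyStable {X : Type*} [MetricSpace X] (F : X → ℝ → X) (zeq : X) : Prop :=
  F zeq 0 = zeq ∧
  (∀ r > 0, ∃ δ > 0, ∀ z₀ : X, dist z₀ zeq < δ →
    ∀ t, dist (trajectory F (fun _ => 0) z₀ t) zeq < r) ∧
  (∀ z₀ : X, Tendsto (trajectory F (fun _ => 0) z₀) atTop (𝓝 zeq))

/-- Input-to-state stability with respect to `zeq`, for all bounded nonnegative inputs. -/
def IsInputToStateStable {X : Type*} [MetricSpace X] (F : X → ℝ → X) (zeq : X) : Prop :=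
  ∃ (b : ℝ → ℝ → ℝ) (g : ℝ → ℝ), ClassKL b ∧ ClassK g ∧
    ∀ (z₀ : X) (u : ℕ → ℝ), IsBoundedInput u →
      ∀ t : ℕ, dist (trajectory F u z₀ t) zeq ≤ b (dist z₀ zeq) t + g (⨆ k, u k)

/-- `V` is an ISS-Lyapunov function (in dissipation form) with respect to `zeq`. -/
def IsISSLyapunovFunction {X : Type*} [MetricSpace X] (F : X → ℝ → X) (zeq : X)
    (V : X → ℝ) : Prop :=
  Continuous V ∧
  (∃ α₁ α₂ : ℝ → ℝ, ClassKInf α₁ ∧ ClassKInf α₂ ∧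
    ∀ z, α₁ (dist z zeq) ≤ V z ∧ V z ≤ α₂ (dist z zeq)) ∧
  (∃ αV χV : ℝ → ℝ, ClassKInf αV ∧ ClassKInf χV ∧
    ∀ (z : X) (u : ℝ), 0 ≤ u → V (F z u) - V z ≤ -αV (dist z zeq) + χV u)

namespace RMSProp

/-- The state space `ℝ^d × ℝ_{≥0}^d` of pairs `(x, s)`. Its metric is the one induced by
the infinity norm of `ℝ^d × ℝ^d`. -/
abbrev State (d : ℕ) : Type :=
  {z : (Fin d → ℝ) × (Fin d → ℝ) // ∀ i, 0 ≤ z.2 i}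

/-- The `i`-th component of the (Euclidean) gradient of `f` at `x`. -/
def grad {d : ℕ} (f : EuclideanSpace ℝ (Fin d) → ℝ) (x : Fin d → ℝ) (i : Fin d) : ℝ :=
  gradient f (WithLp.toLp 2 x) i

/-- `s⁺`. -/
def nextS {d : ℕ} (f : EuclideanSpace ℝ (Fin d) → ℝ) (β : ℝ) (x s : Fin d → ℝ) : Fin d → ℝ :=
  fun i => (1 - β) * s i + β * (grad f x i) ^ 2

/-- `x⁺`, with step size `η₀ + u`. -/
def nextX {d : ℕ} (f : EuclideanSpace ℝ (Fin d) → ℝ) (β ε η₀ : ℝ) (x s : Fin d → ℝ) (u : ℝ) :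
    Fin d → ℝ :=
  fun i => x i - (η₀ + u) / (ε + √(nextS f β x s i)) * grad f x i

theorem nextS_nonneg {d : ℕ} (f : EuclideanSpace ℝ (Fin d) → ℝ) {β : ℝ} (hβ : β ∈ Ioo (0 : ℝ) 1)
    (x s : Fin d → ℝ) (hs : ∀ i, 0 ≤ s i) (i : Fin d) : 0 ≤ nextS f β x s i :=
  add_nonneg (mul_nonneg (sub_nonneg.2 hβ.2.le) (hs i)) (mul_nonneg hβ.1.le (sq_nonneg _))

/-- The RMSProp iteration `((x, s), u) ↦ (x⁺, s⁺)`. -/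
def step {d : ℕ} (f : EuclideanSpace ℝ (Fin d) → ℝ) (β ε η₀ : ℝ) (hβ : β ∈ Ioo (0 : ℝ) 1)
    (z : State d) (u : ℝ) : State d :=
  ⟨(nextX f β ε η₀ z.1.1 z.1.2 u, nextS f β z.1.1 z.1.2),
    nextS_nonneg f hβ z.1.1 z.1.2 z.2⟩

/-- The point `(xstar, 0)` of the state space. -/
def equilibrium {d : ℕ} (xstar : EuclideanSpace ℝ (Fin d)) : State d :=
  ⟨(WithLp.ofLp xstar, 0), fun _ => le_rfl⟩

def gamma₁ (β ε η₀ L : ℝ) : ℝ :=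
  12 * β ^ (3 / 2 : ℝ) * √L / (η₀ * ε)

def gamma₀ (d : ℕ) (β ε η₀ η₁ L : ℝ) : ℝ :=
  max (3 * β / η₀)
    (max (β * ε / (η₀ * (ε - (η₀ + η₁) * L / 2)))
      (gamma₁ β ε η₀ L * η₀ * √(L * d) / √β + 12 * β * L * √d / ε))

def gamma (d : ℕ) (β ε η₀ η₁ L : ℝ) (ω : ℝ) : ℝ :=
  gamma₀ d β ε η₀ η₁ L * ω + 2 / 3 * gamma₁ β ε η₀ L * ω ^ (3 / 2 : ℝ)

def h (ε ω : ℝ) : ℝ :=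
  √ω + ε * Real.log ε - ε * Real.log (√ω + ε)

/-- `V (x, s) = γ (f x - f xstar) + 2 ∑ i, h (s i)`. -/
def lyapunov {d : ℕ} (f : EuclideanSpace ℝ (Fin d) → ℝ) (xstar : EuclideanSpace ℝ (Fin d))
    (β ε η₀ η₁ L : ℝ) (z : State d) : ℝ :=
  gamma d β ε η₀ η₁ L (f (WithLp.toLp 2 z.1.1) - f xstar) + 2 * ∑ i, h ε (z.1.2 i)

end RMSProp

end

/-!
The third claim is the core: input-to-state stability follows from an ISS-Lyapunov function by the
usual comparison argument, and global asymptotic stability is input-to-state stability for the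
zero input.

*From dissipation to stability.* Written in terms of `v t = V (z t)`, the dissipation inequality is
`v (t + 1) ≤ v t - a (v t) + w` with `a` of class `𝒦∞` and `w` a bound for the supply. Either `v t`
has already fallen below `a⁻¹ (2 w) + w`, where it stays, or `v` has lost at least `a (v k) / 2` at
all earlier times `k`, so that `a (v t) (t + 1) ≤ 2 v 0 + a (v 0)`
(`ClassK.le_or_le_of_dissipation`). Solved for `v t`, the latter is an explicit `𝒦ℒ` bound.

*Dissipation for RMSProp.* Let `g` be the gradient at `x`, `Δ = f x - f xstar`, `η = η₀ + u` and
`Sᵢ = ε + √sᵢ⁺`. By the descent lemma `Δ` decreases by at least `∑ᵢ η gᵢ² / Sᵢ (1 - η L / (2 Sᵢ))`,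
and since `h` is concave, `2 (h sᵢ⁺ - h sᵢ) ≤ β (gᵢ² - sᵢ) / (ε + √sᵢ)`. The first two lower bounds
on `γ₀` make the decrease of `γ₀ Δ` exceed the positive part `β gᵢ² / (ε + √sᵢ)` as long as `Sᵢ` is
comparable to `ε + √sᵢ`. Otherwise `|gᵢ|` is large, because `√sᵢ⁺ ≤ √sᵢ + √β |gᵢ|`, and the term
with `ω ^ (3 / 2)` helps: it contributes the decrease of `Δ` multiplied by
`2 / 3 γ₁ √Δ`, and `√Δ ≥ |gᵢ| / √(2 L)`. For `u ≤ η₁` this leaves a decrease by a multiple of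
`∑ᵢ (gᵢ² + sᵢ) / (ε + √sᵢ)` without any supply (`IsAdmissible.exists_lyapunov_step_sub_le_of_le`).
It is strict since `η (ε - η L / 2)` stays strictly above its value in the definition of `γ₀`.

For `u ≥ η₁` the function `f` may increase along a step, but at most by some `K u` independent of
the state, as `√β |gᵢ| ≤ Sᵢ`. The resulting terms are bounded in terms of `u` except for `γ₁ √Δ K u`,
which is absorbed by the decrease `√Δ gᵢ² / Sᵢ` at the largest component of the gradient, or else
by that of `h` (`IsAdmissible.mul_sqrt_le`, `IsAdmissible.exists_lyapunov_step_sub_le`).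

Finally, `∑ᵢ (gᵢ² + sᵢ) / (ε + √sᵢ)` is bounded below by a `𝒦∞` function of the distance to the
equilibrium, by strong convexity (`IsAdmissible.sq_div_add_le_dissipation`).
-/

/-! ### Comparison functions -/

theorem ClassK.nonneg {α : ℝ → ℝ} (hα : ClassK α) {x : ℝ} (hx : 0 ≤ x) : 0 ≤ α x := by
  have h := hα.2.1.monotoneOn (mem_Ici.2 le_rfl) (mem_Ici.2 hx) hx
  rwa [hα.2.2] at h

theorem ClassK.mono {α : ℝ → ℝ} (hα : ClassK α) {x y : ℝ} (hx : 0 ≤ x) (hxy : x ≤ y) :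
    α x ≤ α y :=
  hα.2.1.monotoneOn (mem_Ici.2 hx) (mem_Ici.2 (hx.trans hxy)) hxy

theorem ClassK.comp {α α' : ℝ → ℝ} (hα : ClassK α) (hα' : ClassK α') :
    ClassK fun r => α (α' r) := by
  have hmaps : MapsTo α' (Ici 0) (Ici 0) := fun x hx => hα'.nonneg hx
  refine ⟨hα.1.comp hα'.1 hmaps, hα.2.1.comp hα'.2.1 hmaps, ?_⟩
  simp only [hα'.2.2, hα.2.2]

theorem ClassKInf.comp {α α' : ℝ → ℝ} (hα : ClassKInf α) (hα' : ClassKInf α') :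
    ClassKInf fun r => α (α' r) :=
  ⟨hα.1.comp hα'.1, hα.2.comp hα'.2⟩

theorem ClassK.add {α α' : ℝ → ℝ} (hα : ClassK α) (hα' : ClassK α') :
    ClassK fun r => α r + α' r :=
  ⟨hα.1.add hα'.1, hα.2.1.add hα'.2.1, by simp [hα.2.2, hα'.2.2]⟩

theorem ClassK.const_mul {α : ℝ → ℝ} (hα : ClassK α) {c : ℝ} (hc : 0 < c) :
    ClassK fun r => c * α r :=
  ⟨continuousOn_const.mul hα.1,
    fun _ hx _ hy hxy => mul_lt_mul_of_pos_left (hα.2.1 hx hy hxy) hc, by simp [hα.2.2]⟩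

theorem ClassKInf.const_mul {α : ℝ → ℝ} (hα : ClassKInf α) {c : ℝ} (hc : 0 < c) :
    ClassKInf fun r => c * α r :=
  ⟨hα.1.const_mul hc, hα.2.const_mul_atTop hc⟩

theorem ClassKInf.inf {α α' : ℝ → ℝ} (hα : ClassKInf α) (hα' : ClassKInf α') :
    ClassKInf fun r => min (α r) (α' r) :=
  ⟨⟨hα.1.1.inf hα'.1.1,
    fun _ hx _ hy hxy => min_lt_min (hα.1.2.1 hx hy hxy) (hα'.1.2.1 hx hy hxy),
    by simp [hα.1.2.2, hα'.1.2.2]⟩, tendsto_atTop.2 fun c => by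
      filter_upwards [tendsto_atTop.1 hα.2 c, tendsto_atTop.1 hα'.2 c] with x h₁ h₂
      exact le_min h₁ h₂⟩

theorem classKInf_id : ClassKInf fun r => r :=
  ⟨⟨continuousOn_id, strictMonoOn_id, rfl⟩, tendsto_id⟩

theorem classKInf_sq : ClassKInf fun r => r ^ 2 :=
  ⟨⟨by fun_prop, fun _ hx _ _ hxy => pow_lt_pow_left₀ hxy hx two_ne_zero, by simp⟩,
    tendsto_pow_atTop two_ne_zero⟩

theorem classKInf_sqrt : ClassKInf fun r => √r :=
  ⟨⟨by fun_prop, fun _ hx _ _ hxy => Real.sqrt_lt_sqrt hx hxy, by simp⟩,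
    Real.tendsto_sqrt_atTop⟩

/-- Adding the identity turns a continuous nondecreasing function vanishing at `0` into one of
class `𝒦∞`. -/
theorem classKInf_add_id {α : ℝ → ℝ} (hc : ContinuousOn α (Ici 0)) (hm : MonotoneOn α (Ici 0))
    (h0 : α 0 = 0) : ClassKInf fun r => α r + r := by
  refine ⟨⟨hc.add continuousOn_id, fun x hx y hy hxy => ?_, by simp [h0]⟩, ?_⟩
  · exact add_lt_add_of_le_of_lt (hm hx hy hxy.le) hxy
  · refine tendsto_atTop_mono' _ ?_ tendsto_id
    filter_upwards [eventually_ge_atTop (0 : ℝ)] with x hx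
    have h := hm (mem_Ici.2 le_rfl) (mem_Ici.2 hx) hx
    simp only [id]
    linarith

/-- A function of class `𝒦∞` has an inverse on `[0, ∞)` of class `𝒦∞`. -/
theorem ClassKInf.exists_inverse {α : ℝ → ℝ} (hα : ClassKInf α) :
    ∃ α' : ℝ → ℝ, ClassKInf α' ∧ (∀ x, 0 ≤ x → α' (α x) = x) ∧ ∀ y, 0 ≤ y → α (α' y) = y := by
  -- Extended by the identity to the negative half-line, `α` is an order isomorphism of `ℝ`.
  set A : ℝ → ℝ := fun x => α (max x 0) + min x 0 with hA
  have hApos : ∀ x, 0 ≤ x → A x = α x := fun x hx => by simp [hA, hx]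
  have hAneg : ∀ x, x ≤ 0 → A x = x := fun x hx => by simp [hA, hx, hα.1.2.2]
  have hmono : StrictMono A := by
    intro x y hxy
    rcases le_total 0 x with hx | hx
    · rw [hApos x hx, hApos y (hx.trans hxy.le)]
      exact hα.1.2.1 hx (hx.trans hxy.le) hxy
    · rcases le_total y 0 with hy | hy
      · rwa [hAneg x hx, hAneg y hy]
      · rw [hAneg x hx, hApos y hy]
        rcases hy.eq_or_lt with rfl | hy'
        · rwa [hα.1.2.2]
        · have h := hα.1.2.1 (mem_Ici.2 le_rfl) (mem_Ici.2 hy) hy'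
          rw [hα.1.2.2] at h
          exact hx.trans_lt h
  have hcont : Continuous A := by
    refine Continuous.add ?_ (continuous_id.min continuous_const)
    exact hα.1.1.comp_continuous (continuous_id.max continuous_const) fun x =>
      mem_Ici.2 (le_max_right _ _)
  have hsurj : Function.Surjective A := by
    refine hcont.surjective ?_ ?_
    · refine hα.2.congr' ?_
      filter_upwards [eventually_ge_atTop (0 : ℝ)] with x hx
      exact (hApos x hx).symm
    · refine tendsto_id.congr' ?_
      filter_upwards [eventually_le_atBot (0 : ℝ)] with x hx
      exact (hAneg x hx).symm
  let e : ℝ ≃o ℝ := hmono.orderIsoOfSurjective A hsurj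
  have hee : ∀ x, e x = A x := fun x => rfl
  have he0 : e.symm 0 = 0 := by
    rw [e.symm_apply_eq, hee, hAneg 0 le_rfl]
  refine ⟨e.symm, ⟨⟨e.symm.continuous.continuousOn, e.symm.strictMono.strictMonoOn _, he0⟩,
    e.symm.tendsto_atTop⟩, fun x hx => ?_, fun y hy => ?_⟩
  · rw [e.symm_apply_eq, hee, hApos x hx]
  · have hy' : 0 ≤ e.symm y := by
      rw [← he0]
      exact e.symm.monotone hy
    rw [← hApos _ hy', ← hee, e.apply_symm_apply]

/-! ### Stability from a Lyapunov function -/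

/-- A nonnegative sequence that loses at least `a (v k) / 2` in each of the first `t` steps
satisfies `t * a (v t) ≤ 2 * v 0`, since its losses are at least `a (v t) / 2` each. -/
theorem ClassK.le_of_decrease {a : ℝ → ℝ} (ha : ClassK a) {v : ℕ → ℝ} (hv : ∀ t, 0 ≤ v t) {t : ℕ}
    (hdec : ∀ k < t, v (k + 1) ≤ v k - a (v k) / 2) :
    a (v t) * (t + 1) ≤ 2 * v 0 + a (v 0) := by
  have hmono : ∀ k ≤ t, v k ≤ v 0 ∧ k * a (v k) ≤ 2 * (v 0 - v k) := by
    intro k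
    induction k with
    | zero => intro _; simp
    | succ k ih =>
      intro hk
      obtain ⟨h₁, h₂⟩ := ih (by omega)
      have h₃ := hdec k (by omega)
      have h₄ := ha.nonneg (hv k)
      have h₅ : a (v (k + 1)) ≤ a (v k) := ha.mono (hv _) (by linarith)
      refine ⟨by linarith, ?_⟩
      have h₆ : (k : ℝ) * a (v (k + 1)) ≤ k * a (v k) :=
        mul_le_mul_of_nonneg_left h₅ k.cast_nonneg
      push_cast
      linarith
  obtain ⟨h₁, h₂⟩ := hmono t le_rfl
  have h₃ := ha.mono (hv t) h₁
  have h₄ := hv t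
  linarith

/-- If `v` satisfies the dissipation inequality with decay `a` and supply at most `w`, then at
each time either it has already entered the set `v ≤ a⁻¹ (2 w) + w`, which it cannot leave, or it
has lost at least half of the decay at all previous steps. -/
theorem ClassK.le_or_le_of_dissipation {a : ℝ → ℝ} (ha : ClassK a) {v : ℕ → ℝ}
    (hv : ∀ t, 0 ≤ v t) {w ρ : ℝ} (hw : 0 ≤ w) (hρ : 0 ≤ ρ) (haρ : a ρ = 2 * w)
    (hdis : ∀ t, v (t + 1) ≤ v t - a (v t) + w) (t : ℕ) :
    v t ≤ ρ + w ∨ a (v t) * (t + 1) ≤ 2 * v 0 + a (v 0) := by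
  have key : v t ≤ ρ + w ∨ ∀ k < t, v (k + 1) ≤ v k - a (v k) / 2 := by
    induction t with
    | zero => exact Or.inr fun k hk => absurd hk (by omega)
    | succ t ih =>
      have h₁ := hdis t
      rcases le_total (v t) ρ with h | h
      · have h₂ := ha.nonneg (hv t)
        exact Or.inl (by linarith)
      · have h₂ := ha.mono hρ h
        rcases ih with h₃ | h₃
        · exact Or.inl (by linarith)
        · refine Or.inr fun k hk => ?_
          rcases Nat.lt_succ_iff_lt_or_eq.1 hk with hk' | rfl
          · exact h₃ k hk'
          · linarith
  exact key.imp id fun h => ha.le_of_decrease hv h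

theorem IsISSLyapunovFunction.isInputToStateStable {X : Type*} [MetricSpace X] {F : X → ℝ → X}
    {zeq : X} {V : X → ℝ} (hV : IsISSLyapunovFunction F zeq V) : IsInputToStateStable F zeq := by
  obtain ⟨-, ⟨α₁, α₂, h₁, h₂, hbd⟩, αV, χ, hαV, hχ, hdis⟩ := hV
  obtain ⟨β₁, hβ₁, hβα₁, -⟩ := h₁.exists_inverse
  obtain ⟨β₂, hβ₂, hβα₂, -⟩ := h₂.exists_inverse
  have ha : ClassKInf fun r => αV (β₂ r) := hαV.comp hβ₂
  set a : ℝ → ℝ := fun r => αV (β₂ r) with ha_def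
  obtain ⟨a', ha', ha'a, haa'⟩ := ha.exists_inverse
  have hV0 : ∀ z, 0 ≤ V z := fun z => (h₁.1.nonneg dist_nonneg).trans (hbd z).1
  have hnum : ClassK fun r => 2 * α₂ r + a (α₂ r) :=
    (h₂.1.const_mul two_pos).add (ha.1.comp h₂.1)
  have hsupply : ClassK fun r => a' (2 * χ r) + χ r :=
    (ha'.1.comp (hχ.1.const_mul two_pos)).add hχ.1
  refine ⟨fun r t => β₁ (a' ((2 * α₂ r + a (α₂ r)) / (t + 1))),
    fun r => β₁ (a' (2 * χ r) + χ r), ⟨fun t ht => ?_, fun r hr => ⟨?_, ?_⟩⟩,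
    hβ₁.1.comp hsupply, ?_⟩
  · have hpos : 0 < (t + 1)⁻¹ := by positivity
    have := hβ₁.1.comp (ha'.1.comp (hnum.const_mul hpos))
    simpa only [div_eq_inv_mul] using this
  · intro t ht t' ht' htt'
    have h := hnum.nonneg hr
    have ht0 : (0 : ℝ) ≤ t := ht
    have ht0' : (0 : ℝ) ≤ t' := ht'
    refine hβ₁.1.mono (ha'.1.nonneg (by positivity)) (ha'.1.mono (by positivity) ?_)
    gcongr
  · have h₀ : ContinuousWithinAt (fun y => β₁ (a' y)) (Ici 0) 0 :=
      (hβ₁.1.comp ha'.1).1 0 (mem_Ici.2 le_rfl)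
    have h₁ : Tendsto (fun y => β₁ (a' y)) (𝓝[Ici 0] 0) (𝓝 0) := by
      have := h₀.tendsto
      simpa only [ha'.1.2.2, hβ₁.1.2.2] using this
    refine h₁.comp (tendsto_nhdsWithin_iff.2 ⟨?_, ?_⟩)
    · exact tendsto_const_nhds.div_atTop (tendsto_atTop_add_const_right _ _ tendsto_id)
    · filter_upwards [eventually_ge_atTop (0 : ℝ)] with t ht
      have h := hnum.nonneg hr
      exact mem_Ici.2 (by positivity)
  · intro z₀ u hu t
    set z : ℕ → X := trajectory F u z₀ with hz
    set U : ℝ := ⨆ k, u k with hU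
    have huU : ∀ k, u k ≤ U := fun k => le_ciSup hu.2 k
    have hU0 : 0 ≤ U := (hu.1 0).trans (huU 0)
    have hw : 0 ≤ χ U := hχ.1.nonneg hU0
    have hdecay : ∀ k, V (z (k + 1)) ≤ V (z k) - a (V (z k)) + χ U := by
      intro k
      have e₁ : V (z (k + 1)) - V (z k) ≤ -αV (dist (z k) zeq) + χ (u k) :=
        hdis (z k) (u k) (hu.1 k)
      have e₂ : χ (u k) ≤ χ U := hχ.1.mono (hu.1 k) (huU k)
      have e₃ : β₂ (V (z k)) ≤ dist (z k) zeq := by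
        rw [← hβα₂ _ (dist_nonneg (x := z k) (y := zeq))]
        exact hβ₂.1.mono (hV0 _) (hbd _).2
      have e₄ : a (V (z k)) ≤ αV (dist (z k) zeq) :=
        hαV.1.mono (hβ₂.1.nonneg (hV0 _)) e₃
      linarith
    have hρ0 : 0 ≤ a' (2 * χ U) := ha'.1.nonneg (by positivity)
    have hdist : dist (z t) zeq ≤ β₁ (V (z t)) := by
      rw [← hβα₁ _ (dist_nonneg (x := z t) (y := zeq))]
      exact hβ₁.1.mono (h₁.1.nonneg dist_nonneg) (hbd _).1
    have hr := hnum.nonneg (dist_nonneg (x := z₀) (y := zeq))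
    have hb0 : 0 ≤ β₁ (a' ((2 * α₂ (dist z₀ zeq) + a (α₂ (dist z₀ zeq))) / (t + 1))) :=
      hβ₁.1.nonneg (ha'.1.nonneg (by positivity))
    have hg0 : 0 ≤ β₁ (a' (2 * χ U) + χ U) := hβ₁.1.nonneg (by positivity)
    rcases ha.1.le_or_le_of_dissipation (v := fun k => V (z k)) (fun k => hV0 _) hw hρ0
      (haa' _ (by positivity)) hdecay t with h | h
    · have := hβ₁.1.mono (hV0 _) h
      linarith
    · have e₁ : V z₀ ≤ α₂ (dist z₀ zeq) := (hbd z₀).2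
      have e₂ : a (V z₀) ≤ a (α₂ (dist z₀ zeq)) := ha.1.mono (hV0 _) e₁
      have e₃ : a (V (z t)) ≤ (2 * α₂ (dist z₀ zeq) + a (α₂ (dist z₀ zeq))) / (t + 1) := by
        rw [le_div_iff₀ (by positivity)]
        have h' : a (V (z t)) * (t + 1) ≤ 2 * V z₀ + a (V z₀) := h
        linarith
      have e₄ := ha'.1.mono (ha.1.nonneg (hV0 _)) e₃
      rw [ha'a _ (hV0 _)] at e₄
      have e₅ := hβ₁.1.mono (hV0 _) e₄
      linarith

theorem IsInputToStateStable.isGloballyAsymptoticallyStable {X : Type*} [MetricSpace X]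
    {F : X → ℝ → X} {zeq : X} (hF : IsInputToStateStable F zeq) :
    IsGloballyAsymptoticallyStable F zeq := by
  obtain ⟨b, g, hb, hg, hbd⟩ := hF
  have h0 : ∀ (z₀ : X) (t : ℕ), dist (trajectory F (fun _ => 0) z₀ t) zeq ≤ b (dist z₀ zeq) t := by
    intro z₀ t
    have h := hbd z₀ (fun _ => 0) ⟨fun _ => le_rfl, by simp⟩ t
    simpa only [ciSup_const, hg.2.2, add_zero] using h
  refine ⟨?_, fun r hr => ?_, fun z₀ => ?_⟩
  · have h := h0 zeq 1
    have h₁ : b 0 ((1 : ℕ) : ℝ) = 0 := (hb.1 ((1 : ℕ) : ℝ) (Nat.cast_nonneg 1)).2.2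
    rw [dist_self, h₁] at h
    exact dist_le_zero.1 h
  · have hK := hb.1 0 le_rfl
    have hc : Tendsto (fun y => b y 0) (𝓝[Ici 0] 0) (𝓝 0) := by
      have := (hK.1 0 (mem_Ici.2 le_rfl)).tendsto
      simpa only [hK.2.2] using this
    obtain ⟨δ, hδ, hδr⟩ := Metric.mem_nhdsWithin_iff.1 (hc.eventually (gt_mem_nhds hr))
    refine ⟨δ, hδ, fun z₀ hz₀ t => (h0 z₀ t).trans_lt ?_⟩
    have h₁ : b (dist z₀ zeq) t ≤ b (dist z₀ zeq) 0 :=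
      (hb.2 _ dist_nonneg).1 (mem_Ici.2 le_rfl) (mem_Ici.2 t.cast_nonneg) t.cast_nonneg
    have h₂ : b (dist z₀ zeq) 0 < r := by
      refine hδr ⟨?_, mem_Ici.2 dist_nonneg⟩
      simpa [Real.dist_eq, abs_of_nonneg dist_nonneg] using hz₀
    exact h₁.trans_lt h₂
  · refine tendsto_iff_dist_tendsto_zero.2 ?_
    exact squeeze_zero (fun _ => dist_nonneg) (h0 z₀)
      ((hb.2 _ dist_nonneg).2.comp tendsto_natCast_atTop_atTop)

/-! ### Smooth strongly convex functions -/

section SmoothConvex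

variable {E : Type*} [NormedAddCommGroup E] [InnerProductSpace ℝ E] [CompleteSpace E] {f : E → ℝ}

theorem hasDerivAt_comp_add_smul (hf : Differentiable ℝ f) (x v : E) (t : ℝ) :
    HasDerivAt (fun t : ℝ => f (x + t • v)) (inner ℝ (gradient f (x + t • v)) v) t := by
  have h₁ : HasDerivAt (fun t : ℝ => x + t • v) v t := by
    simpa using ((hasDerivAt_id t).smul_const v).const_add x
  have h₂ := (hf (x + t • v)).hasGradientAt.hasFDerivAt.comp_hasDerivAt t h₁
  rw [InnerProductSpace.toDual_apply_apply] at h₂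
  exact h₂

/-- The descent lemma. -/
theorem le_add_inner_gradient_add_sq (hf : Differentiable ℝ f) {L : ℝ}
    (hL : ∀ x y, ‖gradient f y - gradient f x‖ ≤ L * ‖y - x‖) (x v : E) :
    f (x + v) ≤ f x + inner ℝ (gradient f x) v + L / 2 * ‖v‖ ^ 2 := by
  set ψ : ℝ → ℝ := fun t =>
    f (x + t • v) - t * inner ℝ (gradient f x) v - L / 2 * ‖v‖ ^ 2 * t ^ 2 with hψ
  have hder : ∀ t, HasDerivAt ψ (inner ℝ (gradient f (x + t • v)) v - inner ℝ (gradient f x) v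
      - L * ‖v‖ ^ 2 * t) t := by
    intro t
    have h₁ := ((hasDerivAt_id t).mul_const (inner ℝ (gradient f x) v))
    have h₂ := ((hasDerivAt_pow 2 t).const_mul (L / 2 * ‖v‖ ^ 2))
    refine (((hasDerivAt_comp_add_smul hf x v t).sub h₁).sub h₂).congr_deriv ?_
    push_cast
    ring
  have hanti : AntitoneOn ψ (Icc 0 1) := by
    refine antitoneOn_of_deriv_nonpos (convex_Icc 0 1)
      (fun t _ => (hder t).continuousAt.continuousWithinAt)
      (fun t _ => (hder t).differentiableAt.differentiableWithinAt) fun t ht => ?_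
    rw [interior_Icc] at ht
    rw [(hder t).deriv, ← inner_sub_left]
    have h₁ := real_inner_le_norm (gradient f (x + t • v) - gradient f x) v
    have h₂ := hL x (x + t • v)
    rw [add_sub_cancel_left, norm_smul, Real.norm_of_nonneg ht.1.le] at h₂
    have h₃ := mul_le_mul_of_nonneg_right h₂ (norm_nonneg v)
    nlinarith
  have h := hanti (left_mem_Icc.2 zero_le_one) (right_mem_Icc.2 zero_le_one) zero_le_one
  simp only [hψ, one_smul, zero_smul, add_zero] at h
  linarith

theorem StrongConvexOn.add_inner_gradient_add_sq_le (hf : Differentiable ℝ f) {μ : ℝ}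
    (hμ : StrongConvexOn univ μ f) (x v : E) :
    f x + inner ℝ (gradient f x) v + μ / 2 * ‖v‖ ^ 2 ≤ f (x + v) := by
  have hslope : Tendsto (fun t : ℝ => t⁻¹ * (f (x + t • v) - f x)) (𝓝[>] 0)
      (𝓝 (inner ℝ (gradient f x) v)) := by
    have h := (hasDerivAt_comp_add_smul hf x v 0).tendsto_slope_zero_right
    simpa using h
  have hright : Tendsto (fun t : ℝ => f (x + v) - f x - (1 - t) * (μ / 2 * ‖v‖ ^ 2)) (𝓝[>] 0)
      (𝓝 (f (x + v) - f x - (1 - 0) * (μ / 2 * ‖v‖ ^ 2))) := by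
    refine Tendsto.mono_left ?_ nhdsWithin_le_nhds
    exact Continuous.tendsto (by fun_prop) 0
  have hle := le_of_tendsto_of_tendsto hslope hright ?_
  · linarith
  filter_upwards [Ioo_mem_nhdsGT (zero_lt_one' ℝ)] with t ht
  have h := hμ.2 (mem_univ x) (mem_univ (x + v)) (sub_nonneg.2 ht.2.le) ht.1.le (by ring)
  have hx : (1 - t) • x + t • (x + v) = x + t • v := by module
  have hv : x - (x + v) = -v := by abel
  rw [hx, hv, norm_neg] at h
  simp only [smul_eq_mul] at h
  rw [inv_mul_le_iff₀ ht.1]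
  linarith

variable {xstar : E}

theorem sq_norm_gradient_le (hf : Differentiable ℝ f) {L : ℝ} (hL : 0 < L)
    (hsm : ∀ x y, ‖gradient f y - gradient f x‖ ≤ L * ‖y - x‖) (hmin : ∀ y, f xstar ≤ f y)
    (x : E) : ‖gradient f x‖ ^ 2 ≤ 2 * L * (f x - f xstar) := by
  have h₁ := le_add_inner_gradient_add_sq hf hsm x (-(L⁻¹ • gradient f x))
  have h₂ := hmin (x + -(L⁻¹ • gradient f x))
  rw [norm_neg, inner_neg_right, inner_smul_right, real_inner_self_eq_norm_sq, norm_smul,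
    Real.norm_of_nonneg (by positivity), mul_pow] at h₁
  have h₃ : L / 2 * (L⁻¹ ^ 2 * ‖gradient f x‖ ^ 2) = L⁻¹ * ‖gradient f x‖ ^ 2 / 2 := by
    field_simp
  have h₄ : L * (L⁻¹ * ‖gradient f x‖ ^ 2) = ‖gradient f x‖ ^ 2 := by field_simp
  nlinarith

theorem gradient_eq_zero_of_forall_le (hmin : ∀ y, f xstar ≤ f y) : gradient f xstar = 0 := by
  have h : IsLocalMin f xstar := Eventually.of_forall hmin
  simp [gradient, h.fderiv_eq_zero]

theorem sub_le_sq_norm_sub (hf : Differentiable ℝ f) {L : ℝ}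
    (hsm : ∀ x y, ‖gradient f y - gradient f x‖ ≤ L * ‖y - x‖) (hmin : ∀ y, f xstar ≤ f y)
    (x : E) : f x - f xstar ≤ L / 2 * ‖x - xstar‖ ^ 2 := by
  have h := le_add_inner_gradient_add_sq hf hsm xstar (x - xstar)
  rw [gradient_eq_zero_of_forall_le hmin, inner_zero_left, add_sub_cancel] at h
  linarith

theorem StrongConvexOn.sq_norm_sub_le (hf : Differentiable ℝ f) {μ : ℝ}
    (hμ : StrongConvexOn univ μ f) (hmin : ∀ y, f xstar ≤ f y) (x : E) :
    μ / 2 * ‖x - xstar‖ ^ 2 ≤ f x - f xstar := by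
  have h := hμ.add_inner_gradient_add_sq_le hf xstar (x - xstar)
  rw [gradient_eq_zero_of_forall_le hmin, inner_zero_left, add_sub_cancel] at h
  linarith

/-- The Polyak–Łojasiewicz inequality. -/
theorem StrongConvexOn.sub_le_sq_norm_gradient (hf : Differentiable ℝ f) {μ : ℝ} (hμ0 : 0 < μ)
    (hμ : StrongConvexOn univ μ f) (x : E) :
    2 * μ * (f x - f xstar) ≤ ‖gradient f x‖ ^ 2 := by
  have h := hμ.add_inner_gradient_add_sq_le hf x (xstar - x)
  rw [add_sub_cancel] at h
  have h₁ := neg_le_of_abs_le (abs_real_inner_le_norm (gradient f x) (xstar - x))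
  nlinarith [sq_nonneg (‖gradient f x‖ - μ * ‖xstar - x‖)]

theorem StrongConvexOn.mul_norm_sub_le (hf : Differentiable ℝ f) {μ : ℝ}
    (hμ : StrongConvexOn univ μ f) (hmin : ∀ y, f xstar ≤ f y) (x : E) :
    μ * ‖x - xstar‖ ≤ ‖gradient f x‖ := by
  have h := hμ.add_inner_gradient_add_sq_le hf x (xstar - x)
  rw [add_sub_cancel] at h
  have h₁ := neg_le_of_abs_le (abs_real_inner_le_norm (gradient f x) (xstar - x))
  have h₂ := hμ.sq_norm_sub_le hf hmin x
  rw [norm_sub_rev xstar x] at h h₁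
  rcases (norm_nonneg (x - xstar)).eq_or_lt with h₀ | h₀
  · rw [← h₀, mul_zero]
    exact norm_nonneg _
  · exact le_of_mul_le_mul_right (by nlinarith) h₀

end SmoothConvex

namespace RMSProp

/-! ### The functions `γ` and `h` -/

theorem rpow_three_halves {ω : ℝ} (hω : 0 ≤ ω) : ω ^ (3 / 2 : ℝ) = ω * √ω := by
  rw [show (3 / 2 : ℝ) = 1 + 1 / 2 by norm_num,
    Real.rpow_add_of_nonneg hω zero_le_one (by norm_num), Real.rpow_one, ← Real.sqrt_eq_rpow]

theorem gamma_eq (d : ℕ) (β ε η₀ η₁ L : ℝ) {ω : ℝ} (hω : 0 ≤ ω) :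
    gamma d β ε η₀ η₁ L ω
      = gamma₀ d β ε η₀ η₁ L * ω + 2 / 3 * gamma₁ β ε η₀ L * (ω * √ω) := by
  rw [gamma, rpow_three_halves hω]

theorem h_zero (ε : ℝ) : h ε 0 = 0 := by
  simp [h]

/-- The tangent inequality for `h`, which is concave with `h' ω = 1 / (2 (ε + √ω))`. -/
theorem two_mul_h_sub_le {ε a b : ℝ} (hε : 0 < ε) (ha : 0 ≤ a) (hb : 0 ≤ b) :
    2 * (h ε b - h ε a) ≤ (b - a) / (ε + √a) := by
  -- In the variable `t = √b` the difference of the two sides has derivative `2 * k t`, where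
  -- `k t` has the sign of `t - p`.
  set p := √a with hp
  have hp0 : 0 ≤ p := Real.sqrt_nonneg a
  let k : ℝ → ℝ := fun t => t / (ε + p) - 1 + ε / (t + ε)
  have hk : ∀ t, 0 ≤ t → k t = t * (t - p) / ((ε + p) * (t + ε)) := by
    intro t ht
    have h₁ : t + ε ≠ 0 := by positivity
    have h₂ : ε + p ≠ 0 := by positivity
    simp only [k]
    field_simp
    ring
  let F : ℝ → ℝ := fun t => t ^ 2 / 2 / (ε + p) - t + ε * Real.log (t + ε)
  have hF : ∀ t, 0 ≤ t → HasDerivAt F (k t) t := by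
    intro t ht
    have h₁ : t + ε ≠ 0 := by positivity
    have h₂ := (((hasDerivAt_id t).add_const ε).log h₁).const_mul ε
    have h₃ := (((hasDerivAt_pow 2 t).div_const 2).div_const (ε + p)).sub (hasDerivAt_id t)
    refine (h₃.add h₂).congr_deriv ?_
    simp only [k, id]
    push_cast
    ring
  have hmin : ∀ q, 0 ≤ q → F p ≤ F q := by
    intro q hq
    rcases le_total p q with hpq | hqp
    · have hm : MonotoneOn F (Icc p q) := by
        refine monotoneOn_of_deriv_nonneg (convex_Icc p q)
          (fun t ht => (hF t (hp0.trans ht.1)).continuousAt.continuousWithinAt)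
          (fun t ht => ?_) fun t ht => ?_ <;> rw [interior_Icc] at ht
        · exact (hF t (hp0.trans ht.1.le)).differentiableAt.differentiableWithinAt
        · have ht0 := hp0.trans ht.1.le
          rw [(hF t ht0).deriv, hk t ht0]
          have := sub_nonneg.2 ht.1.le
          positivity
      exact hm (left_mem_Icc.2 hpq) (right_mem_Icc.2 hpq) hpq
    · have hm : AntitoneOn F (Icc q p) := by
        refine antitoneOn_of_deriv_nonpos (convex_Icc q p)
          (fun t ht => (hF t (hq.trans ht.1)).continuousAt.continuousWithinAt)
          (fun t ht => ?_) fun t ht => ?_ <;> rw [interior_Icc] at ht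
        · exact (hF t (hq.trans ht.1.le)).differentiableAt.differentiableWithinAt
        · have ht0 := hq.trans ht.1.le
          rw [(hF t ht0).deriv, hk t ht0]
          exact div_nonpos_of_nonpos_of_nonneg
            (mul_nonpos_of_nonneg_of_nonpos ht0 (sub_nonpos.2 ht.2.le)) (by positivity)
      exact hm (left_mem_Icc.2 hqp) (right_mem_Icc.2 hqp) hqp
  have hq := hmin (√b) (Real.sqrt_nonneg b)
  simp only [F] at hq
  rw [Real.sq_sqrt hb, hp, Real.sq_sqrt ha, ← hp] at hq
  have hsub : (b - a) / (ε + p) = 2 * (b / 2 / (ε + p) - a / 2 / (ε + p)) := by ring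
  rw [hsub, h, h, ← hp]
  linarith

theorem classKInf_h {ε : ℝ} (hε : 0 < ε) : ClassKInf (h ε) := by
  refine ⟨⟨?_, ?_, h_zero ε⟩, ?_⟩
  · have : ∀ ω, √ω + ε ≠ 0 := fun ω => by positivity
    unfold h
    fun_prop (disch := assumption)
  · intro a ha b hb hab
    have h₁ : √a < √b := Real.sqrt_lt_sqrt ha hab
    have h₂ : 0 ≤ √a := Real.sqrt_nonneg a
    have h₃ : 0 < √a + ε := by positivity
    have h₄ : 0 < √b + ε := by positivity
    have h₅ : Real.log ((√b + ε) / (√a + ε)) < (√b + ε) / (√a + ε) - 1 :=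
      Real.log_lt_sub_one_of_pos (by positivity) fun h => by
        rw [div_eq_one_iff_eq h₃.ne'] at h
        linarith
    rw [Real.log_div h₄.ne' h₃.ne', div_sub_one h₃.ne'] at h₅
    have h₆ : ε * ((√b + ε - (√a + ε)) / (√a + ε)) ≤ √b - √a := by
      rw [mul_div_assoc', div_le_iff₀ h₃]
      nlinarith
    have h₇ := mul_lt_mul_of_pos_left h₅ hε
    simp only [h]
    linarith
  · have hlow : ∀ ω, √ω / 2 + (ε * Real.log ε - ε * Real.log (2 * ε) + ε / 2) ≤ h ε ω := by
      intro ω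
      have h₄ : 0 < √ω + ε := by positivity
      have h₅ := Real.log_le_sub_one_of_pos (x := (√ω + ε) / (2 * ε)) (by positivity)
      rw [Real.log_div h₄.ne' (by positivity)] at h₅
      have h₇ := mul_le_mul_of_nonneg_left h₅ hε.le
      have h₈ : ε * ((√ω + ε) / (2 * ε) - 1) = √ω / 2 - ε / 2 := by
        field_simp
        ring
      rw [h₈] at h₇
      simp only [h]
      linarith
    refine tendsto_atTop_mono hlow (tendsto_atTop_add_const_right _ _ ?_)
    exact Real.tendsto_sqrt_atTop.atTop_div_const two_pos

section Gamma

variable {d : ℕ} {β ε η₀ η₁ L : ℝ}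

/-- The term `ω ^ (3 / 2)` decreases at least by `D √a`, because `√` is monotone. -/
theorem gamma_sub_le_of_le (h₀ : 0 ≤ gamma₀ d β ε η₀ η₁ L) (h₁ : 0 ≤ gamma₁ β ε η₀ L)
    {a b D : ℝ} (ha : 0 ≤ a) (hb : 0 ≤ b) (hD : 0 ≤ D) (hab : b ≤ a - D) :
    gamma d β ε η₀ η₁ L b - gamma d β ε η₀ η₁ L a
      ≤ -((gamma₀ d β ε η₀ η₁ L + 2 / 3 * gamma₁ β ε η₀ L * √a) * D) := by
  rw [gamma_eq _ _ _ _ _ _ ha, gamma_eq _ _ _ _ _ _ hb]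
  have h₂ : √b ≤ √a := Real.sqrt_le_sqrt (by linarith)
  have h₃ : b * √b ≤ (a - D) * √a := by
    calc b * √b ≤ b * √a := mul_le_mul_of_nonneg_left h₂ hb
      _ ≤ _ := mul_le_mul_of_nonneg_right hab (Real.sqrt_nonneg a)
  have h₄ := mul_le_mul_of_nonneg_left h₃ h₁
  have h₅ := mul_le_mul_of_nonneg_left hab h₀
  linarith

/-- The increase of `ω ↦ ω ^ (3 / 2)` from `q ^ 2` to `p ^ 2`, when the argument decreases by `G` up
to an overshoot `r ^ 2`. The decrease is kept with the factor `q`. -/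
theorem cube_sub_cube_le {p q r G : ℝ} (hp : 0 ≤ p) (hq : 0 ≤ q) (hr : 0 ≤ r) (hG : 0 ≤ G)
    (h : p ^ 2 ≤ q ^ 2 - G + r ^ 2) :
    p ^ 3 - q ^ 3 ≤ -(q * G) + 3 / 2 * (q * r ^ 2 + r ^ 3) := by
  rcases le_total p q with hpq | hqp
  · have h₁ : p ^ 3 ≤ q * (q ^ 2 - G + r ^ 2) := by
      calc p ^ 3 = p * p ^ 2 := by ring
        _ ≤ q * p ^ 2 := mul_le_mul_of_nonneg_right hpq (sq_nonneg p)
        _ ≤ _ := mul_le_mul_of_nonneg_left h hq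
    have h₂ : 0 ≤ q * r ^ 2 := by positivity
    have h₃ : 0 ≤ r ^ 3 := by positivity
    linarith
  · have h₁ : p ≤ q + r := by
      by_contra! hlt
      nlinarith [mul_nonneg hq hr]
    have h₂ : p ^ 3 - q ^ 3 ≤ 3 / 2 * (p * (p ^ 2 - q ^ 2)) := by
      nlinarith [mul_nonneg (sub_nonneg.2 hqp) (mul_nonneg hp (sub_nonneg.2 hqp)),
        mul_nonneg (sub_nonneg.2 hqp) (mul_nonneg hq (sub_nonneg.2 hqp))]
    have h₃ : p * (p ^ 2 - q ^ 2) ≤ (q + r) * (r ^ 2 - G) :=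
      mul_le_mul h₁ (by linarith) (by nlinarith) (by positivity)
    have h₄ : 0 ≤ q * G := by positivity
    have h₅ : 0 ≤ r * G := by positivity
    nlinarith

theorem gamma_sub_le (h₀ : 0 ≤ gamma₀ d β ε η₀ η₁ L) (h₁ : 0 ≤ gamma₁ β ε η₀ L)
    {a b G K : ℝ} (ha : 0 ≤ a) (hb : 0 ≤ b) (hG : 0 ≤ G) (hK : 0 ≤ K) (hab : b ≤ a - G + K) :
    gamma d β ε η₀ η₁ L b - gamma d β ε η₀ η₁ L a
      ≤ -((gamma₀ d β ε η₀ η₁ L + 2 / 3 * gamma₁ β ε η₀ L * √a) * G)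
        + gamma₀ d β ε η₀ η₁ L * K + gamma₁ β ε η₀ L * (√a * K + K * √K) := by
  rw [gamma_eq _ _ _ _ _ _ ha, gamma_eq _ _ _ _ _ _ hb]
  have h₂ := cube_sub_cube_le (Real.sqrt_nonneg b) (Real.sqrt_nonneg a) (Real.sqrt_nonneg K) hG
    (by rwa [Real.sq_sqrt ha, Real.sq_sqrt hb, Real.sq_sqrt hK])
  have h₃ : ∀ x : ℝ, 0 ≤ x → √x ^ 3 = x * √x := fun x hx => by rw [pow_succ, Real.sq_sqrt hx]
  rw [h₃ a ha, h₃ b hb, h₃ K hK, Real.sq_sqrt hK] at h₂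
  have h₄ := mul_le_mul_of_nonneg_left h₂ h₁
  have h₅ := mul_le_mul_of_nonneg_left hab h₀
  linarith

end Gamma

/-! ### Inequalities for a single coordinate -/

/-- The growth of `√s⁺ = q` over `√s = a`, at most `w`, is compensated by the decrease of the two
parts of `γ`. -/
theorem one_add_div_le {β ε δ a q w T : ℝ} (hβ : 0 ≤ β) (hε : 0 < ε) (hδ : 0 ≤ δ) (hδ' : δ ≤ 1 / 2)
    (ha : 0 ≤ a) (hq : 0 ≤ q) (hw : 0 ≤ w) (hqa : q ≤ a + w)
    (hT : β * (1 + δ) * ε + 3 * β * q + 2 * β * w * q / ε ≤ T) :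
    β * (1 + δ) / (ε + a) ≤ T / (ε + q) ^ 2 := by
  rw [div_le_div_iff₀ (by positivity) (by positivity)]
  have h₁ : (1 + δ) * (ε + q) ^ 2 ≤ ((1 + δ) * ε + 3 * q + 2 * w * q / ε) * (ε + a) := by
    have h₂ : ((1 + δ) * ε + 3 * q + 2 * w * q / ε) * (ε + a)
        = ((1 + δ) * ε + 3 * q) * (ε + a) + 2 * w * q + 2 * w * q * a / ε := by
      field_simp
      ring
    have h₃ : 0 ≤ 2 * w * q * a / ε := by positivity
    have h₄ : q * q ≤ q * (a + w) := mul_le_mul_of_nonneg_left hqa hq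
    have h₅ : δ * (q * q) ≤ 1 / 2 * (q * q) := mul_le_mul_of_nonneg_right hδ' (by positivity)
    have h₆ : δ * (q * ε) ≤ 1 / 2 * (q * ε) := mul_le_mul_of_nonneg_right hδ' (by positivity)
    have h₇ : 0 ≤ δ * (a * ε) := by positivity
    have h₈ : 0 ≤ a * ε := by positivity
    have h₉ : 0 ≤ q * a := by positivity
    have h₁₀ : 0 ≤ q * w := by positivity
    rw [h₂]
    nlinarith
  calc β * (1 + δ) * (ε + q) ^ 2 = β * ((1 + δ) * (ε + q) ^ 2) := by ring
    _ ≤ β * (((1 + δ) * ε + 3 * q + 2 * w * q / ε) * (ε + a)) :=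
      mul_le_mul_of_nonneg_left h₁ hβ
    _ = (β * (1 + δ) * ε + 3 * β * q + 2 * β * w * q / ε) * (ε + a) := by ring
    _ ≤ T * (ε + a) := mul_le_mul_of_nonneg_right hT (by positivity)

/-- The analogue of `one_add_div_le` for steps in which the second-order term of the descent lemma is
estimated separately. -/
theorem two_mul_div_le {β ε P S w T : ℝ} (hβ : 0 ≤ β) (hε : 0 < ε) (hP : ε ≤ P) (hS : 0 < S)
    (hw : 0 ≤ w) (hSP : S ≤ P + w) (hT : 3 * β + 2 * β * w / ε ≤ T) :
    2 * β / P ≤ T / S := by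
  have hP0 : 0 < P := hε.trans_le hP
  rw [div_le_div_iff₀ hP0 hS]
  have h₁ : w ≤ w / ε * P := by
    rw [div_mul_eq_mul_div, le_div_iff₀ hε]
    exact mul_le_mul_of_nonneg_left hP hw
  calc 2 * β * S ≤ 2 * β * (P + w) := mul_le_mul_of_nonneg_left hSP (by positivity)
    _ ≤ 2 * β * (P + w / ε * P) := by gcongr
    _ ≤ 3 * β * P + 2 * β * (w / ε * P) := by nlinarith
    _ = (3 * β + 2 * β * w / ε) * P := by ring
    _ ≤ T * P := mul_le_mul_of_nonneg_right hT hP0.le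

/-- With `r = √(f x - f xstar)`, `y` the largest component of the gradient and `a = √s` at this
component: if the decrease `c r y² / S` does not absorb the linear term `C r`, then `S`, hence
also `a`, is at least of the order of `y²`, and `b a` absorbs it up to a constant. -/
theorem mul_le_add_of_le {b c k C r y a ε S : ℝ} (hb : 0 < b) (hc : 0 < c) (hk : 0 ≤ k)
    (hC : 0 ≤ C) (hr : 0 ≤ r) (hry : r ≤ k * y) (ha : 0 ≤ a) (hε : 0 < ε) (hS : 0 < S)
    (hSa : S ≤ ε + a + y) :
    C * r ≤ c * r * y ^ 2 / S + b * a + (b * ε + (b + C * k) ^ 2 * C / (4 * b * c)) := by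
  have hM : 0 ≤ b * ε + (b + C * k) ^ 2 * C / (4 * b * c) := by positivity
  have hba : 0 ≤ b * a := by positivity
  rcases le_or_gt (C * S) (c * y ^ 2) with h | h
  · have h₁ : C * r ≤ c * r * y ^ 2 / S := by
      rw [le_div_iff₀ hS]
      nlinarith [mul_le_mul_of_nonneg_right h hr]
    linarith
  · have hC0 : 0 < C := by
      rcases hC.eq_or_lt with rfl | hC'
      · have : 0 ≤ c * y ^ 2 := by positivity
        linarith
      · exact hC'
    have h₁ : c * y ^ 2 / C ≤ ε + a + y := by
      rw [div_le_iff₀ hC0]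
      nlinarith [mul_le_mul_of_nonneg_left hSa hC]
    have h₂ : C * r ≤ C * (k * y) := mul_le_mul_of_nonneg_left hry hC
    have h₃ : 0 ≤ c * r * y ^ 2 / S := by positivity
    have h₄ := mul_le_mul_of_nonneg_left h₁ hb.le
    have h₅ : 0 ≤ b * c / C * (y - (b + C * k) * C / (2 * b * c)) ^ 2 := by positivity
    have h₆ : b * c / C * (y - (b + C * k) * C / (2 * b * c)) ^ 2
        = b * (c * y ^ 2 / C) - (b + C * k) * y + (b + C * k) ^ 2 * C / (4 * b * c) := by
      field_simp
      ring
    rw [h₆] at h₅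
    linarith

/-! ### One step of RMSProp -/

/-- The assumptions on the objective function and on the parameters: `f` is differentiable,
`μ`-strongly convex and `L`-smooth with minimizer `xstar`, and the parameters lie in their ranges. -/
structure IsAdmissible {d : ℕ} (f : EuclideanSpace ℝ (Fin d) → ℝ)
    (xstar : EuclideanSpace ℝ (Fin d)) (μ L β ε η₀ η₁ : ℝ) : Prop where
  differentiable : Differentiable ℝ f
  mu_pos : 0 < μ
  strongConvexOn : StrongConvexOn univ μ f
  le_map : ∀ y, f xstar ≤ f y
  L_pos : 0 < L
  smooth : ∀ x y, ‖gradient f y - gradient f x‖ ≤ L * ‖y - x‖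
  beta_mem : β ∈ Ioo (0 : ℝ) 1
  eps_pos : 0 < ε
  eta₀_pos : 0 < η₀
  eta₁_pos : 0 < η₁
  eta_lt : η₀ + η₁ < 2 * ε / L

/-- The denominator `ε + √sᵢ⁺` of the step. -/
noncomputable def denom {d : ℕ} (f : EuclideanSpace ℝ (Fin d) → ℝ) (β ε : ℝ) (x s : Fin d → ℝ)
    (i : Fin d) : ℝ :=
  ε + √(nextS f β x s i)

/-- The quantity `∑ᵢ (gᵢ² + sᵢ) / (ε + √sᵢ)`, where `g` is the gradient at `x`; a multiple of it
bounds the decrease of the Lyapunov function from below. -/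
noncomputable def dissipation {d : ℕ} (f : EuclideanSpace ℝ (Fin d) → ℝ) (ε : ℝ)
    (x s : Fin d → ℝ) : ℝ :=
  ∑ i, (grad f x i ^ 2 + s i) / (ε + √(s i))

section Step

variable {d : ℕ} {f : EuclideanSpace ℝ (Fin d) → ℝ} {xstar : EuclideanSpace ℝ (Fin d)}
  {μ L β ε η₀ η₁ : ℝ} {x s : Fin d → ℝ}

theorem sum_grad_sq (f : EuclideanSpace ℝ (Fin d) → ℝ) (x : Fin d → ℝ) :
    ∑ i, grad f x i ^ 2 = ‖gradient f (WithLp.toLp 2 x)‖ ^ 2 := by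
  simp [EuclideanSpace.norm_sq_eq, grad]

theorem dissipation_nonneg (hε : 0 < ε) (hs : ∀ i, 0 ≤ s i) : 0 ≤ dissipation f ε x s :=
  Finset.sum_nonneg fun i _ => by
    have := hs i
    positivity

namespace IsAdmissible

theorem slack_pos (hA : IsAdmissible f xstar μ L β ε η₀ η₁) : 0 < ε - (η₀ + η₁) * L / 2 := by
  have h := (lt_div_iff₀ hA.L_pos).1 hA.eta_lt
  linarith

theorem gamma₁_pos (hA : IsAdmissible f xstar μ L β ε η₀ η₁) : 0 < gamma₁ β ε η₀ L := by
  have h₁ := hA.beta_mem.1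
  have h₂ := hA.L_pos
  have h₃ := hA.eps_pos
  have h₄ := hA.eta₀_pos
  unfold gamma₁
  positivity

theorem three_mul_le_gamma₀ (hA : IsAdmissible f xstar μ L β ε η₀ η₁) :
    3 * β ≤ gamma₀ d β ε η₀ η₁ L * η₀ :=
  (div_le_iff₀ hA.eta₀_pos).1 (le_max_left _ _)

theorem gamma₀_pos (hA : IsAdmissible f xstar μ L β ε η₀ η₁) : 0 < gamma₀ d β ε η₀ η₁ L := by
  have h₁ := hA.three_mul_le_gamma₀
  have h₂ := hA.beta_mem.1
  exact pos_of_mul_pos_left (by linarith) hA.eta₀_pos.le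

theorem le_gamma₀_mul_slack (hA : IsAdmissible f xstar μ L β ε η₀ η₁) :
    β * ε ≤ gamma₀ d β ε η₀ η₁ L * (η₀ * (ε - (η₀ + η₁) * L / 2)) :=
  (div_le_iff₀ (mul_pos hA.eta₀_pos hA.slack_pos)).1
    ((le_max_left _ _).trans (le_max_right _ _))

theorem sub_nonneg (hA : IsAdmissible f xstar μ L β ε η₀ η₁) (x : EuclideanSpace ℝ (Fin d)) :
    0 ≤ f x - f xstar :=
  _root_.sub_nonneg.2 (hA.le_map x)

/-- Smoothness bounds each component of the gradient by a multiple of `√(f x - f xstar)`; the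
constant `12` in `γ₁` leaves the factor `8`. -/
theorem le_gamma₁_mul_sqrt (hA : IsAdmissible f xstar μ L β ε η₀ η₁) (x : Fin d → ℝ) (i : Fin d) :
    8 * β * (√β * |grad f x i|) / ε
      ≤ gamma₁ β ε η₀ L * η₀ * √(f (WithLp.toLp 2 x) - f xstar) := by
  have h₁ := sq_norm_gradient_le hA.differentiable hA.L_pos hA.smooth hA.le_map (WithLp.toLp 2 x)
  have hβ := hA.beta_mem.1
  have hL := hA.L_pos
  have hε := hA.eps_pos
  have hη := hA.eta₀_pos
  set D := f (WithLp.toLp 2 x) - f xstar with hD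
  have hD0 : 0 ≤ D := hA.sub_nonneg _
  have h₂ : grad f x i ^ 2 ≤ 2 * L * D := by
    refine le_trans ?_ h₁
    rw [← sum_grad_sq]
    exact Finset.single_le_sum (f := fun j => grad f x j ^ 2) (fun j _ => sq_nonneg _)
      (Finset.mem_univ i)
  have h₃ : |grad f x i| ≤ 3 / 2 * (√L * √D) := by
    refine abs_le_of_sq_le_sq (h₂.trans ?_) (by positivity)
    rw [mul_pow, mul_pow, Real.sq_sqrt hL.le, Real.sq_sqrt hD0]
    nlinarith [mul_nonneg hL.le hD0]
  have h₄ : gamma₁ β ε η₀ L * η₀ * √D = 8 * β * (√β * (3 / 2 * (√L * √D))) / ε := by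
    rw [gamma₁, rpow_three_halves hβ.le]
    field_simp
    ring
  rw [h₄]
  gcongr

/-- The descent lemma along one step of RMSProp. -/
theorem map_nextX_le (hA : IsAdmissible f xstar μ L β ε η₀ η₁) (x s : Fin d → ℝ) (u : ℝ) :
    f (WithLp.toLp 2 (nextX f β ε η₀ x s u)) ≤ f (WithLp.toLp 2 x)
      - ∑ i, ((η₀ + u) * grad f x i ^ 2 / denom f β ε x s i
          - L / 2 * ((η₀ + u) / denom f β ε x s i * grad f x i) ^ 2) := by
  set v : EuclideanSpace ℝ (Fin d) :=
    WithLp.toLp 2 fun i => -((η₀ + u) / denom f β ε x s i * grad f x i) with hv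
  have h := le_add_inner_gradient_add_sq hA.differentiable hA.smooth (WithLp.toLp 2 x) v
  have h₁ : WithLp.toLp 2 x + v = WithLp.toLp 2 (nextX f β ε η₀ x s u) := by
    ext i
    simp [hv, nextX, denom, sub_eq_add_neg]
  have h₂ : inner ℝ (gradient f (WithLp.toLp 2 x)) v
      = -∑ i, (η₀ + u) * grad f x i ^ 2 / denom f β ε x s i := by
    rw [PiLp.inner_apply, ← Finset.sum_neg_distrib]
    refine Finset.sum_congr rfl fun i _ => ?_
    simp only [hv, RCLike.inner_apply, conj_trivial, grad]
    ring
  have h₃ : ‖v‖ ^ 2 = ∑ i, ((η₀ + u) / denom f β ε x s i * grad f x i) ^ 2 := by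
    simp only [EuclideanSpace.norm_sq_eq, hv, norm_neg, Real.norm_eq_abs, sq_abs]
  rw [h₁, h₂, h₃] at h
  rw [Finset.sum_sub_distrib, ← Finset.mul_sum]
  linarith

theorem denom_pos (hA : IsAdmissible f xstar μ L β ε η₀ η₁) (x s : Fin d → ℝ) (i : Fin d) :
    0 < denom f β ε x s i :=
  hA.eps_pos.trans_le (le_add_of_nonneg_right (Real.sqrt_nonneg _))

theorem sqrt_nextS_le (hA : IsAdmissible f xstar μ L β ε η₀ η₁) (hs : ∀ i, 0 ≤ s i) (i : Fin d) :
    √(nextS f β x s i) ≤ √(s i) + √β * |grad f x i| := by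
  have hβ := hA.beta_mem.1
  have h₁ := hs i
  have h₂ : 0 ≤ β * s i := by positivity
  have h₃ : 0 ≤ √(s i) * (√β * |grad f x i|) := by positivity
  refine Real.sqrt_le_iff.2 ⟨by positivity, ?_⟩
  rw [add_sq, mul_pow, Real.sq_sqrt h₁, Real.sq_sqrt hβ.le, sq_abs, nextS]
  linarith

theorem sqrt_mul_abs_grad_le (hA : IsAdmissible f xstar μ L β ε η₀ η₁) (hs : ∀ i, 0 ≤ s i)
    (i : Fin d) : √β * |grad f x i| ≤ denom f β ε x s i := by
  have hε := hA.eps_pos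
  have h : √β * |grad f x i| ≤ √(nextS f β x s i) := by
    rw [← Real.sqrt_sq_eq_abs, ← Real.sqrt_mul hA.beta_mem.1.le]
    refine Real.sqrt_le_sqrt ?_
    have := mul_nonneg (_root_.sub_nonneg.2 hA.beta_mem.2.le) (hs i)
    rw [nextS]
    linarith
  rw [denom]
  linarith

theorem lyapunov_step_sub_le (hA : IsAdmissible f xstar μ L β ε η₀ η₁) (hβ : β ∈ Ioo (0 : ℝ) 1)
    (z : State d) (u : ℝ) :
    lyapunov f xstar β ε η₀ η₁ L (step f β ε η₀ hβ z u) - lyapunov f xstar β ε η₀ η₁ L z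
      ≤ gamma d β ε η₀ η₁ L (f (WithLp.toLp 2 (nextX f β ε η₀ z.1.1 z.1.2 u)) - f xstar)
        - gamma d β ε η₀ η₁ L (f (WithLp.toLp 2 z.1.1) - f xstar)
        + ∑ i, β * (grad f z.1.1 i ^ 2 - z.1.2 i) / (ε + √(z.1.2 i)) := by
  have h : 2 * ∑ i, h ε (nextS f β z.1.1 z.1.2 i) - 2 * ∑ i, h ε (z.1.2 i)
      ≤ ∑ i, β * (grad f z.1.1 i ^ 2 - z.1.2 i) / (ε + √(z.1.2 i)) := by
    rw [← mul_sub, ← Finset.sum_sub_distrib, Finset.mul_sum]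
    refine Finset.sum_le_sum fun i _ => ?_
    refine (two_mul_h_sub_le hA.eps_pos (z.2 i) (nextS_nonneg f hβ _ _ z.2 i)).trans_eq ?_
    rw [nextS]
    ring
  simp only [lyapunov, step]
  linarith

/-! ### Decrease of the Lyapunov function for small inputs -/

/-- The concave function `η ↦ η (ε - η L / 2)` exceeds `η₀ (ε - (η₀ + η₁) L / 2)` by a fixed factor
on `[η₀, η₀ + η₁]`. -/
theorem exists_slack (hA : IsAdmissible f xstar μ L β ε η₀ η₁) :
    ∃ δ, 0 < δ ∧ δ ≤ 1 / 2 ∧ ∀ u, 0 ≤ u → u ≤ η₁ →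
      (1 + δ) * (η₀ * (ε - (η₀ + η₁) * L / 2)) ≤ (η₀ + u) * (ε - (η₀ + u) * L / 2) := by
  have hL := hA.L_pos
  have hη₀ := hA.eta₀_pos
  have hη₁ := hA.eta₁_pos
  have hσ := hA.slack_pos
  set σ := ε - (η₀ + η₁) * L / 2 with hσ_def
  have hm : 0 < min σ (η₀ * L / 2) := lt_min hσ (by positivity)
  set m := min σ (η₀ * L / 2) with hm_def
  refine ⟨min (1 / 2) (η₁ * m / (η₀ * σ)), by positivity, min_le_left _ _, fun u hu hu₁ => ?_⟩
  have h₁ : min (1 / 2) (η₁ * m / (η₀ * σ)) * (η₀ * σ) ≤ η₁ * m :=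
    (le_div_iff₀ (by positivity)).1 (min_le_right _ _)
  have h₂ : (η₀ + u) * (ε - (η₀ + u) * L / 2)
      = η₀ * σ + u * σ + (η₁ - u) * (η₀ * L / 2) + u * ((η₁ - u) * L / 2) := by
    rw [hσ_def]
    ring
  have h₃ : 0 ≤ η₁ - u := by linarith
  have h₄ : u * m ≤ u * σ := mul_le_mul_of_nonneg_left (min_le_left _ _) hu
  have h₅ : (η₁ - u) * m ≤ (η₁ - u) * (η₀ * L / 2) :=
    mul_le_mul_of_nonneg_left (min_le_right _ _) h₃
  have h₆ : 0 ≤ u * ((η₁ - u) * L / 2) := by positivity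
  rw [h₂]
  linarith

theorem exists_lyapunov_step_sub_le_of_le (hA : IsAdmissible f xstar μ L β ε η₀ η₁)
    (hβ : β ∈ Ioo (0 : ℝ) 1) :
    ∃ c, 0 < c ∧ ∀ (z : State d) (u : ℝ), 0 ≤ u → u ≤ η₁ →
      lyapunov f xstar β ε η₀ η₁ L (step f β ε η₀ hβ z u) - lyapunov f xstar β ε η₀ η₁ L z
        ≤ -(c * dissipation f ε z.1.1 z.1.2) := by
  obtain ⟨δ, hδ, hδ', hslack⟩ := hA.exists_slack
  have hβ0 := hβ.1
  have hε := hA.eps_pos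
  have hη₀ := hA.eta₀_pos
  refine ⟨β * δ, by positivity, fun z u hu hu₁ => ?_⟩
  obtain ⟨⟨x, s⟩, hs⟩ := z
  refine (hA.lyapunov_step_sub_le hβ _ u).trans ?_
  simp only at hs ⊢
  set D := f (WithLp.toLp 2 x) - f xstar with hD
  have hD0 : 0 ≤ D := hA.sub_nonneg _
  have hσ := hslack u hu hu₁
  have hσ0 := hA.slack_pos
  set σ := ε - (η₀ + η₁) * L / 2 with hσ_def
  set γ₀ := gamma₀ d β ε η₀ η₁ L with hγ₀
  set γ₁ := gamma₁ β ε η₀ L with hγ₁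
  have hγ₀0 : 0 < γ₀ := hA.gamma₀_pos
  have hγ₁0 : 0 < γ₁ := hA.gamma₁_pos
  -- The step size enters each term of the descent lemma through `e i ≥ 0`.
  set e : Fin d → ℝ := fun i =>
    (η₀ + u) * √(nextS f β x s i) + (η₀ + u) * (ε - (η₀ + u) * L / 2) with he
  have hterm : ∀ i, (η₀ + u) * grad f x i ^ 2 / denom f β ε x s i
      - L / 2 * ((η₀ + u) / denom f β ε x s i * grad f x i) ^ 2
      = e i * grad f x i ^ 2 / denom f β ε x s i ^ 2 := by
    intro i
    have h₁ := (hA.denom_pos x s i).ne'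
    have h₂ : √(nextS f β x s i) = denom f β ε x s i - ε := by simp [denom]
    simp only [he, h₂]
    field_simp
    ring
  have hslack0 : 0 ≤ (η₀ + u) * (ε - (η₀ + u) * L / 2) := le_trans (by positivity) hσ
  have he0 : ∀ i, 0 ≤ e i := fun i => by
    have : 0 ≤ (η₀ + u) * √(nextS f β x s i) := by positivity
    simp only [he]
    linarith
  have hdesc := hA.map_nextX_le x s u
  simp only [hterm] at hdesc
  have hgamma := gamma_sub_le_of_le (d := d) (β := β) (ε := ε) (η₀ := η₀) (η₁ := η₁) (L := L)
    hγ₀0.le hγ₁0.le hD0 (hA.sub_nonneg (WithLp.toLp 2 (nextX f β ε η₀ x s u)))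
    (D := ∑ i, e i * grad f x i ^ 2 / denom f β ε x s i ^ 2)
    (Finset.sum_nonneg fun i _ => div_nonneg (mul_nonneg (he0 i) (sq_nonneg _)) (sq_nonneg _))
    (by linarith)
  rw [← hγ₀, ← hγ₁] at hgamma
  have hcoord : ∀ i, β * (1 + δ) / (ε + √(s i)) * grad f x i ^ 2
      ≤ (γ₀ + 2 / 3 * γ₁ * √D) * (e i * grad f x i ^ 2 / denom f β ε x s i ^ 2) := by
    intro i
    set q := √(nextS f β x s i) with hq
    have hq0 : 0 ≤ q := Real.sqrt_nonneg _
    have hei : (1 + δ) * (η₀ * σ) + η₀ * q ≤ e i := by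
      have := mul_nonneg hu hq0
      simp only [he]
      linarith
    have h₁ : β * (1 + δ) * ε + 3 * β * q ≤ γ₀ * e i := by
      have a₁ := mul_le_mul_of_nonneg_left hei hγ₀0.le
      have a₂ := mul_le_mul_of_nonneg_right hA.le_gamma₀_mul_slack (by linarith : 0 ≤ 1 + δ)
      have a₃ := mul_le_mul_of_nonneg_right hA.three_mul_le_gamma₀ hq0
      rw [← hγ₀] at a₂ a₃
      rw [← hσ_def] at a₂
      linarith
    have h₂ : 2 * β * (√β * |grad f x i|) * q / ε ≤ 2 / 3 * γ₁ * √D * e i := by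
      have a₁ := mul_le_mul_of_nonneg_right (hA.le_gamma₁_mul_sqrt x i) hq0
      rw [← hγ₁, ← hD] at a₁
      have a₂ : η₀ * q ≤ e i := by
        have : 0 ≤ (1 + δ) * (η₀ * σ) := by positivity
        linarith
      have a₃ := mul_le_mul_of_nonneg_left a₂ (by positivity : 0 ≤ 2 / 3 * γ₁ * √D)
      have a₄ : 0 ≤ β * (√β * |grad f x i|) * q / ε := by positivity
      have a₅ : 8 * β * (√β * |grad f x i|) / ε * q = 8 * (β * (√β * |grad f x i|) * q / ε) := by
        ring
      have a₆ : 2 * β * (√β * |grad f x i|) * q / ε = 2 * (β * (√β * |grad f x i|) * q / ε) := by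
        ring
      rw [a₆]
      rw [a₅] at a₁
      linarith
    have h₃ := one_add_div_le hβ0.le hε hδ.le hδ' (Real.sqrt_nonneg (s i)) hq0
      (by positivity : 0 ≤ √β * |grad f x i|) (hA.sqrt_nextS_le hs i)
      (T := (γ₀ + 2 / 3 * γ₁ * √D) * e i) (by linarith)
    have h₄ := mul_le_mul_of_nonneg_right h₃ (sq_nonneg (grad f x i))
    refine h₄.trans_eq ?_
    rw [denom]
    ring
  have hsum := Finset.sum_le_sum fun i (_ : i ∈ Finset.univ) => hcoord i
  rw [← Finset.mul_sum] at hsum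
  have hfinal : ∑ i, β * (grad f x i ^ 2 - s i) / (ε + √(s i))
      - ∑ i, β * (1 + δ) / (ε + √(s i)) * grad f x i ^ 2
      ≤ -(β * δ * dissipation f ε x s) := by
    rw [dissipation, Finset.mul_sum, ← Finset.sum_neg_distrib, ← Finset.sum_sub_distrib]
    refine Finset.sum_le_sum fun i _ => ?_
    have h₁ := hs i
    have h₂ : 0 ≤ β * (1 - δ) * (s i / (ε + √(s i))) :=
      mul_nonneg (mul_nonneg hβ0.le (by linarith)) (by positivity)
    have h₃ : -(β * δ * ((grad f x i ^ 2 + s i) / (ε + √(s i))))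
        - (β * (grad f x i ^ 2 - s i) / (ε + √(s i))
          - β * (1 + δ) / (ε + √(s i)) * grad f x i ^ 2)
        = β * (1 - δ) * (s i / (ε + √(s i))) := by
      ring
    linarith
  linarith

end IsAdmissible

end Step

/-! ### Decrease of the Lyapunov function up to a supply for arbitrary inputs -/

/-- The largest increase of `f` that the second-order term of the descent lemma allows in a step
with input `u`. It is finite because each component of the step is at most `(η₀ + u) / √β`. -/
noncomputable def overshoot (d : ℕ) (L β η₀ u : ℝ) : ℝ :=
  d * (L / 2 * ((η₀ + u) ^ 2 / β))

section Step

variable {d : ℕ} {f : EuclideanSpace ℝ (Fin d) → ℝ} {xstar : EuclideanSpace ℝ (Fin d)}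
  {μ L β ε η₀ η₁ : ℝ} {x s : Fin d → ℝ}

namespace IsAdmissible

theorem overshoot_nonneg (hA : IsAdmissible f xstar μ L β ε η₀ η₁) (u : ℝ) :
    0 ≤ overshoot d L β η₀ u := by
  have hβ := hA.beta_mem.1
  have hL := hA.L_pos
  unfold overshoot
  positivity

theorem overshoot_mono (hA : IsAdmissible f xstar μ L β ε η₀ η₁) {u v : ℝ} (hu : 0 ≤ u)
    (huv : u ≤ v) : overshoot d L β η₀ u ≤ overshoot d L β η₀ v := by
  have hβ := hA.beta_mem.1
  have hL := hA.L_pos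
  have hη := hA.eta₀_pos
  unfold overshoot
  gcongr

theorem map_nextX_le_add_overshoot (hA : IsAdmissible f xstar μ L β ε η₀ η₁)
    (hs : ∀ i, 0 ≤ s i) (u : ℝ) :
    f (WithLp.toLp 2 (nextX f β ε η₀ x s u)) ≤ f (WithLp.toLp 2 x)
      - ∑ i, (η₀ + u) * grad f x i ^ 2 / denom f β ε x s i + overshoot d L β η₀ u := by
  have hL := hA.L_pos
  have h := hA.map_nextX_le x s u
  rw [Finset.sum_sub_distrib] at h
  have h₁ : ∑ i, L / 2 * ((η₀ + u) / denom f β ε x s i * grad f x i) ^ 2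
      ≤ ∑ _i : Fin d, L / 2 * ((η₀ + u) ^ 2 / β) := by
    refine Finset.sum_le_sum fun i _ => mul_le_mul_of_nonneg_left ?_ (by positivity)
    have h₂ := pow_le_pow_left₀ (by positivity) (hA.sqrt_mul_abs_grad_le (x := x) hs i) 2
    rw [mul_pow, Real.sq_sqrt hA.beta_mem.1.le, sq_abs] at h₂
    rw [mul_pow, div_pow, div_mul_eq_mul_div,
      div_le_div_iff₀ (pow_pos (hA.denom_pos x s i) 2) hA.beta_mem.1]
    calc (η₀ + u) ^ 2 * grad f x i ^ 2 * β = (η₀ + u) ^ 2 * (β * grad f x i ^ 2) := by ring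
      _ ≤ _ := mul_le_mul_of_nonneg_left h₂ (sq_nonneg _)
  rw [Finset.sum_const, Finset.card_univ, Fintype.card_fin, nsmul_eq_mul] at h₁
  rw [overshoot]
  linarith

/-- The term linear in `√(f x - f xstar)` that a large input contributes to the change of the
Lyapunov function is absorbed by one third of the decrease of `ω ^ (3 / 2)` together with half of
the decrease of `h`. -/
theorem mul_sqrt_le (hA : IsAdmissible f xstar μ L β ε η₀ η₁) (hs : ∀ i, 0 ≤ s i) {u : ℝ}
    (hu : 0 ≤ u) {C : ℝ} (hC : 0 ≤ C) :
    C * √(f (WithLp.toLp 2 x) - f xstar)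
      ≤ 1 / 3 * gamma₁ β ε η₀ L * √(f (WithLp.toLp 2 x) - f xstar)
          * ∑ i, (η₀ + u) * grad f x i ^ 2 / denom f β ε x s i
        + β / 2 * ∑ i, s i / (ε + √(s i))
        + (β * ε + (β / 2 + C * √(d / (2 * μ))) ^ 2 * C
            / (4 * (β / 2) * (1 / 3 * gamma₁ β ε η₀ L * η₀))) := by
  have hβ := hA.beta_mem.1
  have hβ' := hA.beta_mem.2
  have hε := hA.eps_pos
  have hη := hA.eta₀_pos
  have hμ := hA.mu_pos
  have hγ₁ := hA.gamma₁_pos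
  set D := f (WithLp.toLp 2 x) - f xstar with hD
  have hD0 : 0 ≤ D := hA.sub_nonneg _
  have hPL : 2 * μ * D ≤ ∑ i, grad f x i ^ 2 := by
    rw [sum_grad_sq]
    exact hA.strongConvexOn.sub_le_sq_norm_gradient hA.differentiable hμ _
  have hG : ∀ i, 0 ≤ (η₀ + u) * grad f x i ^ 2 / denom f β ε x s i := fun i => by
    have := hA.denom_pos x s i
    positivity
  have hH : ∀ i, 0 ≤ s i / (ε + √(s i)) := fun i => by
    have := hs i
    positivity
  have hG' := Finset.sum_nonneg fun i (_ : i ∈ Finset.univ) => hG i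
  have hH' := Finset.sum_nonneg fun i (_ : i ∈ Finset.univ) => hH i
  rcases isEmpty_or_nonempty (Fin d) with hd | hd
  · rw [Finset.univ_eq_empty, Finset.sum_empty] at hPL
    have hD' : D = 0 := le_antisymm (by nlinarith) hD0
    rw [hD', Real.sqrt_zero, mul_zero]
    positivity
  -- `m` is the index of the largest component of the gradient.
  · obtain ⟨m, -, hm⟩ := Finset.exists_max_image Finset.univ (fun i => |grad f x i|)
      Finset.univ_nonempty
    have hsum : ∑ i, grad f x i ^ 2 ≤ d * |grad f x m| ^ 2 := by
      have := Finset.sum_le_card_nsmul Finset.univ (fun i => grad f x i ^ 2) (|grad f x m| ^ 2)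
        fun i hi => by
          rw [← sq_abs (grad f x i)]
          exact pow_le_pow_left₀ (abs_nonneg _) (hm i hi) 2
      simpa using this
    have hr : √D ≤ √(d / (2 * μ)) * |grad f x m| := by
      rw [← Real.sqrt_sq (abs_nonneg (grad f x m)), ← Real.sqrt_mul (by positivity)]
      refine Real.sqrt_le_sqrt ?_
      rw [div_mul_eq_mul_div, le_div_iff₀ (by positivity)]
      linarith
    have hS : denom f β ε x s m ≤ ε + √(s m) + |grad f x m| := by
      have h₁ := hA.sqrt_nextS_le (x := x) hs m
      have h₂ : √β * |grad f x m| ≤ 1 * |grad f x m| :=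
        mul_le_mul_of_nonneg_right (Real.sqrt_le_one.2 hβ'.le) (abs_nonneg _)
      rw [denom]
      linarith
    have key := mul_le_add_of_le (b := β / 2) (c := 1 / 3 * gamma₁ β ε η₀ L * η₀) (by positivity)
      (by positivity) (Real.sqrt_nonneg _) hC (Real.sqrt_nonneg D) hr (Real.sqrt_nonneg (s m)) hε
      (hA.denom_pos x s m) hS
    have h₁ : 1 / 3 * gamma₁ β ε η₀ L * η₀ * √D * |grad f x m| ^ 2 / denom f β ε x s m
        ≤ 1 / 3 * gamma₁ β ε η₀ L * √D
          * ∑ i, (η₀ + u) * grad f x i ^ 2 / denom f β ε x s i := by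
      have h₂ := Finset.single_le_sum (fun i _ => hG i) (Finset.mem_univ m)
      have h₃ := hA.denom_pos x s m
      have h₄ : η₀ * grad f x m ^ 2 / denom f β ε x s m
          ≤ (η₀ + u) * grad f x m ^ 2 / denom f β ε x s m := by
        gcongr
        linarith
      calc 1 / 3 * gamma₁ β ε η₀ L * η₀ * √D * |grad f x m| ^ 2 / denom f β ε x s m
          = 1 / 3 * gamma₁ β ε η₀ L * √D * (η₀ * grad f x m ^ 2 / denom f β ε x s m) := by
            rw [sq_abs]
            ring
        _ ≤ _ := mul_le_mul_of_nonneg_left (h₄.trans h₂) (by positivity)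
    have h₂ : √(s m) ≤ ∑ i, s i / (ε + √(s i)) + ε := by
      have h₃ := Finset.single_le_sum (fun i _ => hH i) (Finset.mem_univ m)
      have h₄ : √(s m) - ε ≤ s m / (ε + √(s m)) := by
        rw [le_div_iff₀ (by positivity)]
        nlinarith [Real.mul_self_sqrt (hs m)]
      linarith
    have h₃ := mul_le_mul_of_nonneg_left h₂ (by positivity : 0 ≤ β / 2)
    linarith

theorem exists_lyapunov_step_sub_le (hA : IsAdmissible f xstar μ L β ε η₀ η₁)
    (hβ : β ∈ Ioo (0 : ℝ) 1) :
    ∃ X : ℝ → ℝ, Continuous X ∧ MonotoneOn X (Ici 0) ∧ 0 ≤ X 0 ∧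
      ∀ (z : State d) (u : ℝ), 0 ≤ u →
        lyapunov f xstar β ε η₀ η₁ L (step f β ε η₀ hβ z u) - lyapunov f xstar β ε η₀ η₁ L z
          ≤ -(β / 2 * dissipation f ε z.1.1 z.1.2) + X u := by
  have hβ0 := hβ.1
  have hε := hA.eps_pos
  have hη := hA.eta₀_pos
  have hμ := hA.mu_pos
  have hγ₀0 := hA.gamma₀_pos
  have hγ₁0 := hA.gamma₁_pos
  have hK0 := hA.overshoot_nonneg
  set γ₀ := gamma₀ d β ε η₀ η₁ L with hγ₀
  set γ₁ := gamma₁ β ε η₀ L with hγ₁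
  set K := overshoot d L β η₀ with hK
  refine ⟨fun u => γ₀ * K u + γ₁ * (K u * √(K u))
    + (β * ε + (β / 2 + γ₁ * K u * √(d / (2 * μ))) ^ 2 * (γ₁ * K u)
        / (4 * (β / 2) * (1 / 3 * γ₁ * η₀))), ?_, fun u hu v _ huv => ?_, ?_, fun z u hu => ?_⟩
  · have hKc : Continuous K := by
      rw [hK]
      unfold overshoot
      fun_prop
    fun_prop
  · have h₁ : K u ≤ K v := hA.overshoot_mono hu huv
    have h₂ := hK0 u
    have h₃ := hK0 v
    dsimp only
    gcongr
  · have := hK0 0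
    positivity
  obtain ⟨⟨x, s⟩, hs⟩ := z
  refine (hA.lyapunov_step_sub_le hβ _ u).trans ?_
  simp only at hs ⊢
  set D := f (WithLp.toLp 2 x) - f xstar with hD
  have hD0 : 0 ≤ D := hA.sub_nonneg _
  set G := ∑ i, (η₀ + u) * grad f x i ^ 2 / denom f β ε x s i with hG
  have hG0 : 0 ≤ G := Finset.sum_nonneg fun i _ => by
    have := hA.denom_pos x s i
    positivity
  have hdesc := hA.map_nextX_le_add_overshoot (x := x) hs u
  rw [← hG, ← hK] at hdesc
  have hgamma := gamma_sub_le (d := d) (β := β) (ε := ε) (η₀ := η₀) (η₁ := η₁) (L := L)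
    hγ₀0.le hγ₁0.le hD0 (hA.sub_nonneg (WithLp.toLp 2 (nextX f β ε η₀ x s u))) hG0 (hK0 u)
    (by linarith)
  rw [← hγ₀, ← hγ₁] at hgamma
  have hres := hA.mul_sqrt_le (x := x) hs hu (mul_nonneg hγ₁0.le (hK0 u))
  rw [← hγ₁, ← hD, ← hG] at hres
  have hcoord : ∀ i, 2 * β / (ε + √(s i)) * grad f x i ^ 2
      ≤ (γ₀ + 1 / 3 * γ₁ * √D) * ((η₀ + u) * grad f x i ^ 2 / denom f β ε x s i) := by
    intro i
    have h₁ : 3 * β ≤ γ₀ * (η₀ + u) := by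
      have := mul_nonneg hγ₀0.le hu
      have := hA.three_mul_le_gamma₀
      rw [← hγ₀] at this
      linarith
    have h₂ : 2 * β * (√β * |grad f x i|) / ε ≤ 1 / 3 * γ₁ * √D * (η₀ + u) := by
      have a₁ := hA.le_gamma₁_mul_sqrt x i
      rw [← hγ₁, ← hD] at a₁
      have a₂ : 0 ≤ γ₁ * √D * u := by positivity
      have a₃ : 0 ≤ β * (√β * |grad f x i|) / ε := by positivity
      have a₄ : 8 * β * (√β * |grad f x i|) / ε = 8 * (β * (√β * |grad f x i|) / ε) := by ring
      have a₅ : 2 * β * (√β * |grad f x i|) / ε = 2 * (β * (√β * |grad f x i|) / ε) := by ring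
      rw [a₅]
      rw [a₄] at a₁
      linarith
    have h₃ := two_mul_div_le hβ0.le hε (le_add_of_nonneg_right (Real.sqrt_nonneg (s i)))
      (hA.denom_pos x s i) (by positivity : 0 ≤ √β * |grad f x i|)
      (by
        have := hA.sqrt_nextS_le (x := x) hs i
        rw [denom]
        linarith)
      (T := (γ₀ + 1 / 3 * γ₁ * √D) * (η₀ + u)) (by linarith)
    refine (mul_le_mul_of_nonneg_right h₃ (sq_nonneg (grad f x i))).trans_eq ?_
    ring
  have hsum := Finset.sum_le_sum fun i (_ : i ∈ Finset.univ) => hcoord i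
  rw [← Finset.mul_sum, ← hG] at hsum
  have hfinal : ∑ i, β * (grad f x i ^ 2 - s i) / (ε + √(s i))
      - ∑ i, 2 * β / (ε + √(s i)) * grad f x i ^ 2 + β / 2 * ∑ i, s i / (ε + √(s i))
      ≤ -(β / 2 * dissipation f ε x s) := by
    rw [dissipation, Finset.mul_sum, Finset.mul_sum, ← Finset.sum_neg_distrib,
      ← Finset.sum_sub_distrib, ← Finset.sum_add_distrib]
    refine Finset.sum_le_sum fun i _ => ?_
    have h₁ : 0 ≤ β / 2 * (grad f x i ^ 2 / (ε + √(s i))) := by positivity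
    have h₃ : -(β / 2 * ((grad f x i ^ 2 + s i) / (ε + √(s i))))
        - (β * (grad f x i ^ 2 - s i) / (ε + √(s i)) - 2 * β / (ε + √(s i)) * grad f x i ^ 2
          + β / 2 * (s i / (ε + √(s i))))
        = β / 2 * (grad f x i ^ 2 / (ε + √(s i))) := by
      ring
    linarith
  linarith

end IsAdmissible

end Step

/-! ### Bounds in terms of the distance to the equilibrium -/

theorem classKInf_sq_div_add {ε : ℝ} (hε : 0 < ε) : ClassKInf fun t => t ^ 2 / (ε + t) := by
  refine ⟨⟨?_, fun a ha b hb hab => ?_, by simp⟩, ?_⟩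
  · refine ContinuousOn.div (by fun_prop) (by fun_prop) fun t ht => ?_
    have : (0 : ℝ) ≤ t := ht
    positivity
  · have ha' : (0 : ℝ) ≤ a := ha
    have hb' : (0 : ℝ) ≤ b := hb
    rw [div_lt_div_iff₀ (by positivity) (by positivity)]
    nlinarith [mul_nonneg (mul_nonneg ha' hb') (sub_nonneg.2 hab.le), mul_pos hε (sub_pos.2 hab),
      mul_pos (mul_pos hε (sub_pos.2 hab)) (by linarith : 0 < a + b)]
  · refine tendsto_atTop_mono' _ ?_ (tendsto_atTop_add_const_right _ (-ε) tendsto_id)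
    filter_upwards [eventually_ge_atTop (0 : ℝ)] with t ht
    rw [le_div_iff₀ (by positivity)]
    simp only [id]
    nlinarith [sq_nonneg ε]

section Distance

variable {d : ℕ} {f : EuclideanSpace ℝ (Fin d) → ℝ} {xstar : EuclideanSpace ℝ (Fin d)}
  {μ L β ε η₀ η₁ : ℝ}

theorem dist_equilibrium_le {z : State d} {r : ℝ} (hr : 0 ≤ r)
    (hx : ∀ i, |z.1.1 i - xstar i| ≤ r) (hs : ∀ i, z.1.2 i ≤ r) :
    dist z (equilibrium xstar) ≤ r := by
  rw [Subtype.dist_eq, Prod.dist_eq]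
  refine max_le ((dist_pi_le_iff hr).2 fun i => ?_) ((dist_pi_le_iff hr).2 fun i => ?_)
  · simpa [equilibrium, Real.dist_eq] using hx i
  · simpa [equilibrium, Real.dist_eq, abs_of_nonneg (z.2 i)] using hs i

theorem abs_sub_le_dist_equilibrium (z : State d) (i : Fin d) :
    |z.1.1 i - xstar i| ≤ dist z (equilibrium xstar) := by
  rw [Subtype.dist_eq, Prod.dist_eq, ← Real.dist_eq]
  exact (dist_le_pi_dist z.1.1 (WithLp.ofLp xstar) i).trans (le_max_left _ _)

theorem snd_le_dist_equilibrium (z : State d) (i : Fin d) :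
    z.1.2 i ≤ dist z (equilibrium xstar) := by
  rw [Subtype.dist_eq, Prod.dist_eq]
  refine le_trans ?_ (le_max_right _ _)
  refine le_trans ?_ (dist_le_pi_dist z.1.2 0 i)
  simp [le_abs_self]

theorem abs_sub_le_norm_sub (x : Fin d → ℝ) (i : Fin d) :
    |x i - xstar i| ≤ ‖WithLp.toLp 2 x - xstar‖ :=
  PiLp.norm_apply_le (WithLp.toLp 2 x - xstar) i

namespace IsAdmissible

/-- The `i`-th term of the dissipation is at least `φ |gᵢ|` and `φ (√sᵢ)`, where
`φ t = t ^ 2 / (ε + t)`; inverting `φ` bounds all components of the gradient and of `√s`. -/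
theorem sq_div_add_le_dissipation (hA : IsAdmissible f xstar μ L β ε η₀ η₁) (z : State d) :
    (min (μ / (d + 1) * dist z (equilibrium xstar)) √(dist z (equilibrium xstar))) ^ 2
      / (ε + min (μ / (d + 1) * dist z (equilibrium xstar)) √(dist z (equilibrium xstar)))
      ≤ dissipation f ε z.1.1 z.1.2 := by
  have hε := hA.eps_pos
  have hμ := hA.mu_pos
  obtain ⟨φ', hφ', hφ'φ, hφφ'⟩ := (classKInf_sq_div_add hε).exists_inverse
  have hdis := dissipation_nonneg (f := f) (x := z.1.1) hε z.2
  set Φ := dissipation f ε z.1.1 z.1.2 with hΦ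
  set t := φ' Φ with ht
  have ht0 : 0 ≤ t := hφ'.1.nonneg hdis
  have hsingle : ∀ i, (grad f z.1.1 i ^ 2 + z.1.2 i) / (ε + √(z.1.2 i)) ≤ Φ := fun i =>
    Finset.single_le_sum (f := fun i => (grad f z.1.1 i ^ 2 + z.1.2 i) / (ε + √(z.1.2 i)))
      (fun j _ => by
        have := z.2 j
        positivity) (Finset.mem_univ i)
  have hof : ∀ a, 0 ≤ a → a ^ 2 / (ε + a) ≤ Φ → a ≤ t := by
    intro a ha h
    have h₁ := hφ'.1.mono (by positivity) h
    rwa [hφ'φ a ha] at h₁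
  have hsqrt : ∀ i, √(z.1.2 i) ≤ t := by
    intro i
    have h₀ := z.2 i
    refine hof _ (Real.sqrt_nonneg _) (le_trans ?_ (hsingle i))
    rw [Real.sq_sqrt h₀]
    gcongr
    exact le_add_of_nonneg_left (sq_nonneg _)
  have hgrad : ∀ i, |grad f z.1.1 i| ≤ t := by
    intro i
    have h₀ := z.2 i
    rcases le_total |grad f z.1.1 i| √(z.1.2 i) with h | h
    · exact h.trans (hsqrt i)
    · refine hof _ (abs_nonneg _) (le_trans ?_ (hsingle i))
      rw [sq_abs]
      gcongr
      exact le_add_of_nonneg_right h₀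
  have hnorm : ‖gradient f (WithLp.toLp 2 z.1.1)‖ ≤ (d + 1) * t := by
    refine le_of_sq_le_sq ?_ (by positivity)
    rw [← sum_grad_sq]
    have h₁ := Finset.sum_le_card_nsmul Finset.univ (fun i => grad f z.1.1 i ^ 2) (t ^ 2)
      fun i _ => by
        rw [← sq_abs (grad f z.1.1 i)]
        exact pow_le_pow_left₀ (abs_nonneg _) (hgrad i) 2
    rw [Finset.card_univ, Fintype.card_fin, nsmul_eq_mul] at h₁
    have hd : (0 : ℝ) ≤ d := d.cast_nonneg
    nlinarith [mul_nonneg hd (sq_nonneg t), mul_nonneg (mul_nonneg hd hd) (sq_nonneg t),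
      sq_nonneg t]
  have hx : ∀ i, |z.1.1 i - xstar i| ≤ (d + 1) / μ * t := by
    intro i
    have h₁ := hA.strongConvexOn.mul_norm_sub_le hA.differentiable hA.le_map
      (WithLp.toLp 2 z.1.1)
    have h₂ := abs_sub_le_norm_sub (xstar := xstar) z.1.1 i
    rw [div_mul_eq_mul_div, le_div_iff₀ hμ]
    nlinarith
  have hs : ∀ i, z.1.2 i ≤ t ^ 2 := by
    intro i
    rw [← Real.sq_sqrt (z.2 i)]
    exact pow_le_pow_left₀ (Real.sqrt_nonneg _) (hsqrt i) 2
  have hdist : dist z (equilibrium xstar) ≤ max ((d + 1) / μ * t) (t ^ 2) :=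
    dist_equilibrium_le (le_max_of_le_right (sq_nonneg t)) (fun i => le_max_of_le_left (hx i))
      fun i => le_max_of_le_right (hs i)
  set r := dist z (equilibrium xstar) with hr
  have hr0 : 0 ≤ r := dist_nonneg
  have hmin : min (μ / (d + 1) * r) √r ≤ t := by
    rcases le_max_iff.1 hdist with h | h
    · refine (min_le_left _ _).trans ?_
      calc μ / (d + 1) * r ≤ μ / (d + 1) * ((d + 1) / μ * t) := by gcongr
        _ = t := by field_simp
    · exact (min_le_right _ _).trans (Real.sqrt_le_iff.2 ⟨ht0, h⟩)
  have h₁ := (classKInf_sq_div_add hε).1.mono (by positivity) hmin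
  rwa [hφφ' Φ hdis] at h₁

theorem continuous_lyapunov (hA : IsAdmissible f xstar μ L β ε η₀ η₁) :
    Continuous (lyapunov f xstar β ε η₀ η₁ L) := by
  have hf := hA.differentiable.continuous
  have hε := hA.eps_pos
  have hγ : Continuous (gamma d β ε η₀ η₁ L) := by
    have : Continuous fun ω : ℝ => ω ^ (3 / 2 : ℝ) :=
      Real.continuous_rpow_const (by norm_num)
    unfold gamma
    fun_prop
  have hh : Continuous (h ε) := by
    have : ∀ ω, √ω + ε ≠ 0 := fun ω => by positivity
    unfold h
    fun_prop (disch := assumption)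
  unfold lyapunov
  fun_prop

theorem gamma_monotoneOn (hA : IsAdmissible f xstar μ L β ε η₀ η₁) :
    MonotoneOn (gamma d β ε η₀ η₁ L) (Ici 0) := by
  intro a ha b _ hab
  have h₀ := hA.gamma₀_pos
  have h₁ := hA.gamma₁_pos
  have ha' : (0 : ℝ) ≤ a := ha
  unfold gamma
  gcongr

theorem exists_le_lyapunov (hA : IsAdmissible f xstar μ L β ε η₀ η₁) :
    ∃ α : ℝ → ℝ, ClassKInf α ∧
      ∀ z, α (dist z (equilibrium xstar)) ≤ lyapunov f xstar β ε η₀ η₁ L z := by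
  have hε := hA.eps_pos
  have hμ := hA.mu_pos
  have h₀ := hA.gamma₀_pos
  have h₁ := hA.gamma₁_pos
  have hK₁ : ClassKInf fun r => gamma₀ d β ε η₀ η₁ L * (μ / 2) * r ^ 2 :=
    classKInf_sq.const_mul (by positivity)
  have hK₂ : ClassKInf fun r => 2 * h ε r := (classKInf_h hε).const_mul two_pos
  refine ⟨_, hK₁.inf hK₂, fun z => ?_⟩
  have hh : ∀ i, 0 ≤ h ε (z.1.2 i) := fun i => (classKInf_h hε).1.nonneg (z.2 i)
  have hD := hA.sub_nonneg (WithLp.toLp 2 z.1.1)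
  have hD' := hA.strongConvexOn.sq_norm_sub_le hA.differentiable hA.le_map (WithLp.toLp 2 z.1.1)
  have hγ : gamma₀ d β ε η₀ η₁ L * (f (WithLp.toLp 2 z.1.1) - f xstar)
      ≤ gamma d β ε η₀ η₁ L (f (WithLp.toLp 2 z.1.1) - f xstar) := by
    unfold gamma
    exact le_add_of_nonneg_right (by positivity)
  have hγ0 := mul_nonneg h₀.le hD
  have hsum := Finset.sum_nonneg fun i (_ : i ∈ Finset.univ) => hh i
  obtain ⟨κ₁, hκ₁, hκ₁', hκ₁''⟩ := hK₁.exists_inverse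
  obtain ⟨κ₂, hκ₂, hκ₂', hκ₂''⟩ := hK₂.exists_inverse
  set v := lyapunov f xstar β ε η₀ η₁ L z with hv
  have hv' : v = gamma d β ε η₀ η₁ L (f (WithLp.toLp 2 z.1.1) - f xstar)
    + 2 * ∑ i, h ε (z.1.2 i) := rfl
  have hv0 : 0 ≤ v := by linarith
  have hx : ∀ i, |z.1.1 i - xstar i| ≤ κ₁ v := by
    intro i
    have a₁ : gamma₀ d β ε η₀ η₁ L * (μ / 2) * |z.1.1 i - xstar i| ^ 2 ≤ v := by
      have a₂ := pow_le_pow_left₀ (abs_nonneg _) (abs_sub_le_norm_sub (xstar := xstar) z.1.1 i) 2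
      have a₃ := mul_le_mul_of_nonneg_left a₂ (by positivity : 0 ≤ μ / 2)
      have a₄ := mul_le_mul_of_nonneg_left (a₃.trans hD') h₀.le
      linarith
    have a₅ := hκ₁.1.mono (by positivity) a₁
    rwa [hκ₁' _ (abs_nonneg _)] at a₅
  have hs : ∀ i, z.1.2 i ≤ κ₂ v := by
    intro i
    have a₁ : 2 * h ε (z.1.2 i) ≤ v := by
      have := Finset.single_le_sum (fun i _ => hh i) (Finset.mem_univ i)
      linarith
    have a₅ := hκ₂.1.mono (mul_nonneg two_pos.le (hh i)) a₁
    rwa [hκ₂' _ (z.2 i)] at a₅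
  have hdist : dist z (equilibrium xstar) ≤ max (κ₁ v) (κ₂ v) :=
    dist_equilibrium_le (le_max_of_le_left (hκ₁.1.nonneg hv0))
      (fun i => le_max_of_le_left (hx i)) fun i => le_max_of_le_right (hs i)
  rcases le_max_iff.1 hdist with h | h
  · have := hK₁.1.mono dist_nonneg h
    rw [hκ₁'' v hv0] at this
    exact (min_le_left _ _).trans this
  · have := hK₂.1.mono dist_nonneg h
    rw [hκ₂'' v hv0] at this
    exact (min_le_right _ _).trans this

theorem exists_lyapunov_le (hA : IsAdmissible f xstar μ L β ε η₀ η₁) :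
    ∃ α : ℝ → ℝ, ClassKInf α ∧
      ∀ z, lyapunov f xstar β ε η₀ η₁ L z ≤ α (dist z (equilibrium xstar)) := by
  have hε := hA.eps_pos
  have hL := hA.L_pos
  have hcγ : ContinuousOn (gamma d β ε η₀ η₁ L) (Ici 0) := by
    have : Continuous fun ω : ℝ => ω ^ (3 / 2 : ℝ) :=
      Real.continuous_rpow_const (by norm_num)
    unfold gamma
    fun_prop
  have hm := hA.gamma_monotoneOn
  have hmaps : MapsTo (fun r : ℝ => L / 2 * (d * r ^ 2)) (Ici 0) (Ici 0) := fun r _ =>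
    mem_Ici.2 (by positivity)
  -- The summand `r` keeps the bound strictly increasing when `d = 0`.
  have hα : ClassKInf fun r =>
      (gamma d β ε η₀ η₁ L (L / 2 * (d * r ^ 2)) + 2 * (d * h ε r)) + r := by
    refine classKInf_add_id ?_ ?_ ?_
    · have h₁ := hcγ.comp (by fun_prop) hmaps
      have h₂ := (classKInf_h hε).1.1
      exact h₁.add (continuousOn_const.mul (continuousOn_const.mul h₂))
    · intro a ha b hb hab
      have h₁ : h ε a ≤ h ε b := (classKInf_h hε).1.mono ha hab
      have ha' : (0 : ℝ) ≤ a := ha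
      have h₂ : L / 2 * (d * a ^ 2) ≤ L / 2 * (d * b ^ 2) := by gcongr
      have h₃ := hm (hmaps ha) (hmaps hb) h₂
      dsimp only
      gcongr
    · simp [gamma, h_zero]
  refine ⟨_, hα, fun z => ?_⟩
  set r := dist z (equilibrium xstar) with hr
  have hr0 : 0 ≤ r := dist_nonneg
  have hD := hA.sub_nonneg (WithLp.toLp 2 z.1.1)
  have h₁ : f (WithLp.toLp 2 z.1.1) - f xstar ≤ L / 2 * (d * r ^ 2) := by
    refine (sub_le_sq_norm_sub hA.differentiable hA.smooth hA.le_map _).trans ?_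
    refine mul_le_mul_of_nonneg_left ?_ (by positivity)
    rw [EuclideanSpace.norm_sq_eq]
    have := Finset.sum_le_card_nsmul Finset.univ
      (fun i => ‖(WithLp.toLp 2 z.1.1 - xstar) i‖ ^ 2) (r ^ 2)
      fun i _ => pow_le_pow_left₀ (norm_nonneg _) (abs_sub_le_dist_equilibrium z i) 2
    simpa using this
  have h₂ := hm hD (hmaps hr0) h₁
  have h₃ : ∑ i, h ε (z.1.2 i) ≤ d * h ε r := by
    have := Finset.sum_le_card_nsmul Finset.univ (fun i => h ε (z.1.2 i)) (h ε r)
      fun i _ => (classKInf_h hε).1.mono (z.2 i) (snd_le_dist_equilibrium z i)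
    simpa using this
  rw [lyapunov]
  linarith

/-- For inputs up to `η₁` no supply is needed; the factor `u / η₁` makes the supply for larger
inputs vanish at `0`. -/
theorem isISSLyapunovFunction (hA : IsAdmissible f xstar μ L β ε η₀ η₁)
    (hβ : β ∈ Ioo (0 : ℝ) 1) :
    IsISSLyapunovFunction (step f β ε η₀ hβ) (equilibrium xstar)
      (lyapunov f xstar β ε η₀ η₁ L) := by
  obtain ⟨α₁, hα₁, hle₁⟩ := hA.exists_le_lyapunov
  obtain ⟨α₂, hα₂, hle₂⟩ := hA.exists_lyapunov_le
  refine ⟨hA.continuous_lyapunov, ⟨α₁, α₂, hα₁, hα₂, fun z => ⟨hle₁ z, hle₂ z⟩⟩, ?_⟩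
  obtain ⟨c, hc, hsmall⟩ := hA.exists_lyapunov_step_sub_le_of_le hβ
  obtain ⟨X, hXc, hXm, hX0, hlarge⟩ := hA.exists_lyapunov_step_sub_le hβ
  have hβ0 := hβ.1
  have hμ := hA.mu_pos
  have hη₁ := hA.eta₁_pos
  have hX : ∀ u, 0 ≤ u → 0 ≤ X u := fun u hu =>
    hX0.trans (hXm (mem_Ici.2 le_rfl) (mem_Ici.2 hu) hu)
  set c' := min c (β / 2) with hc'
  have hc'0 : 0 < c' := lt_min hc (by positivity)
  have hK : ClassKInf fun r => min (μ / (d + 1) * r) √r :=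
    (classKInf_id.const_mul (by positivity)).inf classKInf_sqrt
  have hχ : ClassKInf fun u => X u * (u / η₁) + u := by
    refine classKInf_add_id ?_ ?_ (by simp)
    · exact (by fun_prop : Continuous fun u => X u * (u / η₁)).continuousOn
    · intro a ha b hb hab
      have ha' : (0 : ℝ) ≤ a := ha
      have h₁ := hXm ha hb hab
      have h₂ := hX b hb
      dsimp only
      gcongr
  refine ⟨_, _, ((classKInf_sq_div_add hA.eps_pos).comp hK).const_mul hc'0, hχ, fun z u hu => ?_⟩
  have hΦ := dissipation_nonneg (f := f) (x := z.1.1) hA.eps_pos z.2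
  have h₁ := mul_le_mul_of_nonneg_left (hA.sq_div_add_le_dissipation z) hc'0.le
  have h₂ := mul_nonneg (hX u hu) (div_nonneg hu hη₁.le)
  rcases le_total u η₁ with h | h
  · have h₃ := hsmall z u hu h
    have h₄ := mul_le_mul_of_nonneg_right (min_le_left c (β / 2)) hΦ
    linarith
  · have h₃ := hlarge z u hu
    have h₄ := mul_le_mul_of_nonneg_right (min_le_right c (β / 2)) hΦ
    have h₅ : X u * 1 ≤ X u * (u / η₁) :=
      mul_le_mul_of_nonneg_left ((one_le_div hη₁).2 h) (hX u hu)
    linarith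

end IsAdmissible

end Distance

end RMSProp

theorem theorem1 {d : ℕ} (f : EuclideanSpace ℝ (Fin d) → ℝ) (xstar : EuclideanSpace ℝ (Fin d))
    (μ L β ε η₀ η₁ : ℝ)
    (hf : ContDiff ℝ 1 f)
    (hμ : 0 < μ) (hconv : StrongConvexOn Set.univ μ f)
    (hmin : ∀ y, f xstar ≤ f y)
    (hL : 0 < L) (hsmooth : ∀ x y, ‖gradient f y - gradient f x‖ ≤ L * ‖y - x‖)
    (hβ : β ∈ Set.Ioo (0 : ℝ) 1) (hε : 0 < ε)
    (hη₀ : η₀ ∈ Set.Ioo 0 (2 * ε / L))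
    (hη₁ : 0 < η₁) (hη : η₀ + η₁ < 2 * ε / L) :
    IsGloballyAsymptoticallyStable (RMSProp.step f β ε η₀ hβ) (RMSProp.equilibrium xstar) ∧
    IsInputToStateStable (RMSProp.step f β ε η₀ hβ) (RMSProp.equilibrium xstar) ∧
    IsISSLyapunovFunction (RMSProp.step f β ε η₀ hβ) (RMSProp.equilibrium xstar)
      (RMSProp.lyapunov f xstar β ε η₀ η₁ L) := by
  have hA : RMSProp.IsAdmissible f xstar μ L β ε η₀ η₁ :=
    ⟨hf.differentiable one_ne_zero, hμ, hconv, hmin, hL, hsmooth, hβ, hε, hη₀.1, hη₁, hη⟩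
  have hV := hA.isISSLyapunovFunction hβ
  have hISS := hV.isInputToStateStable
  exact ⟨hISS.isGloballyAsymptoticallyStable, hISS, hV⟩
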